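/- **Conventions.** A measured compact metric space is a nonempty compact metric space $(X,d)$ with a finite Borel measure $\mu$; $\mathscr S$ is the collection of these spaces with the topology and Borel $\sigma$-algebra of the Gromov–Hausdorff–Prokhorov pseudometric $$d_{\mathrm{GHP}}(X_1,X_2)=\inf_{C,\pi}\max\Big(\tfrac12\,\mathrm{dis}(C),\ \|\mu_1-\pi_1\|+\|\mu_2-\pi_2\|,\ \pi(C^c)\Big),$$ the infimum being over measurable correspondences $C$ and finite measures $\pi$ on $X_1\times X_2$ with marginals $\pi_1,\pi_2$, where $\mathrm{dis}(C)=\sup\{|d_1(x_1,y_1)-d_2(x_2,y_2)|:(x_1,x_2),(y_1,y_2)\in C\}$ and $\|\cdot\|$ is total variation. Sequences of spaces carry the product $\sigma$-algebra on $\mathscr S^{\mathbb N}$. For $\alpha,\beta>0$, $\mathrm{scl}(\alpha,\beta)\cdot(X,d,\mu)=(X,\alpha d,\beta\mu)$, applied to every term of a sequence of spaces. **Trees with shortcuts.** Let $h,g$ be excursions of length $l$ (continuous, zero at $0$ and $l$, positive in between) and $\mathcal P\subset[0,\infty)^2$ a countable set with finitely many points $(x,y)$ such that $0\le x\le l$ and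 $0\le y<g(x)$. Put $d_h(s,t)=h(s)+h(t)-2\inf_{[s\wedge t,\,s\vee t]}h$. Then $\mathcal G(h,g,\mathcal P)$ is the real tree $[0,l]/\{d_h=0\}$ in which, for each of these points $(x,y)$, the images of $x$ and of $r(x,y)=\inf\{x'\ge x: g(x')\le y\}$ are identified (with the quotient metric), equipped with the push-forward of Lebesgue measure on $[0,l]$. **Ingredients.** For $\kappa,\sigma>0$ and $\lambda\in\mathbb R$ let $W^\lambda_{\kappa,\sigma}(s)=\kappa B(s)+\lambda s-\sigma s^2/2$, with $B$ a standard Brownian motion, and let $\xi^\lambda_{\kappa,\sigma}=(\xi^\lambda_{\kappa,\sigma}(i))_{i\ge1}$ be the lengths, in decreasing order, of the excursions above $0$ of $W^\lambda_{\kappa,\sigma}(s)-\min_{u\le s}W^\lambda_{\kappa,\sigma}(u)$. For $l,\theta>0$ the tilted excursion $\tilde e^\theta_l$ has density proportional to $\exp(\theta\int_0^l h(s)\,ds)$ with respect to the law of the standard Brownian excursion of length $l$; write $\tilde e_l=\tilde e_l^1$. Let $\mathcal P_1,\mathcal P_2,\dots$ be independent rate one Poisson point processes on $[0,\infty)^2$.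 **Limit objects.** Let $\sigma_1,\sigma_3>0$ and $\lambda\in\mathbb R$. * Rank-one limit $\mathbf M(\lambda)=(M_i(\lambda))_{i\ge1}$: let $(Z_i)_{i\ge1}=\xi^\lambda_{\sqrt{\sigma_3/\sigma_1},\,\sigma_3/\sigma_1^2}$; given $(Z_i)$, let $h_i$ be independent excursions with the law of $\tilde e_{Z_i}^{\theta}$, $\theta=\sigma_3^{1/2}/\sigma_1^{3/2}$; let $(\mathcal P_i)$ be independent of $((Z_i),(h_i))$; and put $$M_i(\lambda)=\mathcal G\Big(\tfrac{2\sigma_1^{1/2}}{\sigma_3^{1/2}}h_i,\ \tfrac{\sigma_3^{1/2}}{\sigma_1^{3/2}}h_i,\ \mathcal P_i\Big).$$ * Erdős–Rényi limit $\mathbf M^{\mathrm{er}}(\lambda)=(M_i^{\mathrm{er}}(\lambda))_{i\ge1}$: let $(\gamma_i)_{i\ge1}=\xi^\lambda_{1,1}$; given $(\gamma_i)$, let $h_i$ be independent excursions with the law of $\tilde e_{\gamma_i}$; let $(\mathcal P_i)$ be independent of $((\gamma_i),(h_i))$; and put $M_i^{\mathrm{er}}(\lambda)=\mathcal G(2h_i,h_i,\mathcal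 P_i)$. **Lemma 4.1.** For all $\sigma_1,\sigma_3>0$ and $\lambda\in\mathbb R$, $\mathbf M(\lambda)$ and $\mathbf M^{\mathrm{er}}(\lambda\sigma_1/\sigma_3^{2/3})$ are $\mathscr S^{\mathbb N}$-valued random variables, and $$\mathbf M(\lambda)\ \stackrel{d}{=}\ \mathrm{scl}\Big(\frac{\sigma_1}{\sigma_3^{2/3}},\frac{\sigma_1}{\sigma_3^{1/3}}\Big)\cdot\mathbf M^{\mathrm{er}}\Big(\frac{\lambda\sigma_1}{\sigma_3^{2/3}}\Big)$$ as random sequences of measured compact metric spaces. -/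

import Mathlib

open MeasureTheory ProbabilityTheory
open scoped NNReal ENNReal

noncomputable section

/-! ### Measured compact metric spaces and the Gromov–Hausdorff–Prokhorov topology -/

/-- A (nonempty) compact metric space with a finite measure on its Borel `σ`-algebra. -/
structure MMSpace : Type 1 where
  carrier : Type
  [metric : MetricSpace carrier]
  [compact : CompactSpace carrier]
  [nonempty : Nonempty carrier]
  [measurable : MeasurableSpace carrier]
  [borel : BorelSpace carrier]
  μ : Measure carrier
  [finite : IsFiniteMeasure μ]

namespace MMSpace

attribute [instance] metric compact nonempty measurable borel finite

/-- A correspondence: a measurable relation whose two projections are onto. -/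
def IsCorrespondence (X Y : MMSpace) (C : Set (X.carrier × Y.carrier)) : Prop :=
  MeasurableSet C ∧ (∀ x, ∃ y, (x, y) ∈ C) ∧ (∀ y, ∃ x, (x, y) ∈ C)

/-- The distortion of a relation. -/
def distortion (X Y : MMSpace) (C : Set (X.carrier × Y.carrier)) : ℝ≥0∞ :=
  ⨆ p ∈ C, ⨆ q ∈ C, ENNReal.ofReal |dist p.1 q.1 - dist p.2 q.2|

/-- The total variation norm of the signed measure `μ - ν`. -/
def tvDist {α : Type} [MeasurableSpace α] (μ ν : Measure α)
    [IsFiniteMeasure μ] [IsFiniteMeasure ν] : ℝ≥0∞ :=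
  (μ.toSignedMeasure - ν.toSignedMeasure).totalVariation Set.univ

/-- The discrepancy of a measure `π` on the product: the total variation distances of its two
marginals to the measures of the two spaces, added up. -/
def discrepancy (X Y : MMSpace) (π : FiniteMeasure (X.carrier × Y.carrier)) : ℝ≥0∞ :=
  tvDist X.μ ((π : Measure (X.carrier × Y.carrier)).map Prod.fst) +
    tvDist Y.μ ((π : Measure (X.carrier × Y.carrier)).map Prod.snd)

/-- The Gromov–Hausdorff–Prokhorov distance. -/
def ghpDist (X Y : MMSpace) : ℝ≥0∞ :=
  ⨅ (C : Set (X.carrier × Y.carrier)) (_ : IsCorrespondence X Y C)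
    (π : FiniteMeasure (X.carrier × Y.carrier)),
    max (distortion X Y C / 2)
      (max (discrepancy X Y π) ((π : Measure (X.carrier × Y.carrier)) Cᶜ))

/-- The topology of the pseudometric `ghpDist`: a set is open if it contains a ball around each of
its points. -/
instance : TopologicalSpace MMSpace where
  IsOpen U := ∀ X ∈ U, ∃ ε : ℝ≥0∞, 0 < ε ∧ ∀ Y, ghpDist X Y < ε → Y ∈ U
  isOpen_univ := fun _ _ => ⟨1, one_pos, fun _ _ => Set.mem_univ _⟩
  isOpen_inter := by
    intro U V hU hV X hX
    obtain ⟨ε, hε, h⟩ := hU X hX.1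
    obtain ⟨δ, hδ, h'⟩ := hV X hX.2
    exact ⟨min ε δ, lt_min hε hδ, fun Y hY =>
      ⟨h Y (hY.trans_le (min_le_left _ _)), h' Y (hY.trans_le (min_le_right _ _))⟩⟩
  isOpen_sUnion := by
    intro S hS X hX
    obtain ⟨U, hU, hXU⟩ := hX
    obtain ⟨ε, hε, h⟩ := hS U hU X hXU
    exact ⟨ε, hε, fun Y hY => ⟨U, hU, h Y hY⟩⟩

/-- The Borel `σ`-algebra. Its members do not separate spaces at distance `0`, so that a law on it
is the same as a law on the space of isometry classes. -/
instance : MeasurableSpace MMSpace := _root_.borel MMSpace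

instance : BorelSpace MMSpace := ⟨rfl⟩

/-- The metric `α • d`, for `α > 0`. -/
@[reducible] def scaleMetric {X : Type} [MetricSpace X] (α : ℝ) (hα : 0 < α) : MetricSpace X where
  dist x y := α * dist x y
  dist_self x := by simp
  dist_comm x y := by simp [dist_comm]
  dist_triangle x y z := by
    have := mul_le_mul_of_nonneg_left (dist_triangle x y z) hα.le
    linarith
  eq_of_dist_eq_zero := by
    intro x y h
    rcases mul_eq_zero.1 h with h | h
    · exact absurd h hα.ne'
    · exact dist_eq_zero.1 h
  toUniformSpace := inferInstance
  uniformity_dist := by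
    rw [Metric.uniformity_basis_dist.eq_biInf]
    apply le_antisymm
    · refine le_iInf₂ fun ε hε => iInf₂_le_of_le (ε / α) (div_pos hε hα) ?_
      refine Filter.principal_mono.2 fun p hp => ?_
      have : dist p.1 p.2 < ε / α := hp
      rw [lt_div_iff₀ hα] at this
      simpa [mul_comm] using this
    · refine le_iInf₂ fun ε hε => iInf₂_le_of_le (α * ε) (mul_pos hα hε) ?_
      refine Filter.principal_mono.2 fun p hp => ?_
      have : α * dist p.1 p.2 < α * ε := hp
      exact lt_of_mul_lt_mul_left this hα.le

/-- The scaling operator: distances are multiplied by `α`, the measure by `β`. -/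
def scl (α β : ℝ) (hα : 0 < α) (X : MMSpace) : MMSpace :=
  { carrier := X.carrier
    metric := scaleMetric (X := X.carrier) α hα
    compact := X.compact
    nonempty := X.nonempty
    measurable := X.measurable
    borel := X.borel
    μ := β.toNNReal • X.μ }

end MMSpace

/-! ### Real trees coded by functions, with shortcuts -/

/-- Continuous paths on `[0, ∞)`. An excursion of length `l` is such a path that vanishes
outside `(0, l)` and is positive on `(0, l)`. -/
abbrev ContPath := C(ℝ≥0, ℝ)

/-- The `σ`-algebra on paths generated by the evaluations. -/
instance : MeasurableSpace ContPath :=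
  MeasurableSpace.comap (fun h : ContPath => (h : ℝ≥0 → ℝ)) inferInstance

/-- Lebesgue measure on `[0, ∞)`. -/
def lebesgueNN : Measure ℝ≥0 := (volume : Measure ℝ).comap NNReal.toReal

theorem lebesgueNN_Icc_lt_top (l : ℝ≥0) : lebesgueNN (Set.Icc 0 l) < ∞ := by
  rw [lebesgueNN, NNReal.isClosedEmbedding_coe.measurableEmbedding.comap_apply]
  refine (measure_mono (t := Set.Icc (0 : ℝ) l) ?_).trans_lt isCompact_Icc.measure_lt_top
  rintro _ ⟨x, hx, rfl⟩
  exact ⟨x.2, NNReal.coe_le_coe.2 hx.2⟩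

/-- The tree pseudodistance `d_h(s, t) = h(s) + h(t) - 2 inf_{[s, t]} h`. -/
def treeDist (h : ContPath) (s t : ℝ≥0) : ℝ :=
  h s + h t - 2 * sInf (h '' Set.uIcc s t)

/-- The length of the chain `s → u₁ ⇝ v₁ → u₂ ⇝ v₂ → ⋯ → t` that travels by `d` and jumps from
`uᵢ` to `vᵢ` at no cost, along the list of the jumps `(uᵢ, vᵢ)`. -/
def chainCost {X : Type} (d : X → X → ℝ) : List (X × X) → X → X → ℝ
  | [], s, t => d s t
  | p :: L, s, t => d s p.1 + chainCost d L p.2 t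

/-- The quotient pseudodistance of `d` when `u` and `v` are identified whenever `R u v`: the
infimum of the lengths of chains that jump only between identified points. -/
def quotDist {X : Type} (d : X → X → ℝ) (R : X → X → Prop) (s t : X) : ℝ :=
  ⨅ L : {L : List (X × X) // ∀ p ∈ L, R p.1 p.2 ∨ R p.2 p.1}, chainCost d L.1 s t

/-- The end `r(x, y) = inf {x' ≥ x : g(x') ≤ y}` of the shortcut started at `x`. -/
def shortcutEnd (g : ContPath) (x y : ℝ≥0) : ℝ≥0 :=
  sInf {x' | x ≤ x' ∧ g x' ≤ y}

/-- The identifications of `x` with `r(x, y)`, for the points `(x, y)` of `Q` under the graph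
of `g` on `[0, l]`. -/
def Shortcut (g : ContPath) (l : ℝ≥0) (Q : Set (ℝ≥0 × ℝ≥0)) (u v : Set.Icc (0 : ℝ≥0) l) : Prop :=
  ∃ p ∈ Q, (p.2 : ℝ) < g p.1 ∧ (u : ℝ≥0) = p.1 ∧ (v : ℝ≥0) = shortcutEnd g p.1 p.2

/-! The facts that make `quotDist` a pseudometric. -/

theorem bddBelow_image_uIcc (h : ContPath) (s t : ℝ≥0) : BddBelow (h '' Set.uIcc s t) :=
  (isCompact_uIcc.image h.continuous).bddBelow

theorem treeDist_self (h : ContPath) (s : ℝ≥0) : treeDist h s s = 0 := by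
  simp [treeDist]; ring

theorem treeDist_comm (h : ContPath) (s t : ℝ≥0) : treeDist h s t = treeDist h t s := by
  simp only [treeDist, Set.uIcc_comm s t]; ring

theorem sInf_uIcc_le (h : ContPath) {s t u : ℝ≥0} (hu : u ∈ Set.uIcc s t) :
    sInf (h '' Set.uIcc s t) ≤ h u :=
  csInf_le (bddBelow_image_uIcc h s t) ⟨u, hu, rfl⟩

theorem treeDist_nonneg (h : ContPath) (s t : ℝ≥0) : 0 ≤ treeDist h s t := by
  have h1 := sInf_uIcc_le h (Set.left_mem_uIcc (a := s) (b := t))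
  have h2 := sInf_uIcc_le h (Set.right_mem_uIcc (a := s) (b := t))
  unfold treeDist; linarith

theorem treeDist_triangle (h : ContPath) (s t u : ℝ≥0) :
    treeDist h s u ≤ treeDist h s t + treeDist h t u := by
  have h1 := sInf_uIcc_le h (Set.right_mem_uIcc (a := s) (b := t))
  have h2 := sInf_uIcc_le h (Set.left_mem_uIcc (a := t) (b := u))
  have key : min (sInf (h '' Set.uIcc s t)) (sInf (h '' Set.uIcc t u)) ≤
      sInf (h '' Set.uIcc s u) := by
    refine le_csInf (Set.nonempty_uIcc.image h) ?_
    rintro _ ⟨x, hx, rfl⟩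
    rcases Set.uIcc_subset_uIcc_union_uIcc (b := t) hx with hx | hx
    · exact (min_le_left _ _).trans (sInf_uIcc_le h hx)
    · exact (min_le_right _ _).trans (sInf_uIcc_le h hx)
  unfold treeDist
  rcases le_total (sInf (h '' Set.uIcc s t)) (sInf (h '' Set.uIcc t u)) with hle | hle
  · rw [min_eq_left hle] at key; linarith
  · rw [min_eq_right hle] at key; linarith

section QuotDist

variable {X : Type} (d : X → X → ℝ) (R : X → X → Prop)

theorem chainCost_nonneg (h0 : ∀ s t, 0 ≤ d s t) (L : List (X × X)) (s t : X) :
    0 ≤ chainCost d L s t := by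
  induction L generalizing s with
  | nil => exact h0 s t
  | cons p L ih => exact add_nonneg (h0 _ _) (ih _)

theorem chainCost_append (h3 : ∀ s t u, d s u ≤ d s t + d t u)
    (L K : List (X × X)) (s t u : X) :
    chainCost d (L ++ K) s u ≤ chainCost d L s t + chainCost d K t u := by
  induction L generalizing s with
  | nil =>
    cases K with
    | nil => exact h3 s t u
    | cons p K =>
      have := h3 s t p.1
      simp only [List.nil_append, chainCost]; linarith
  | cons p L ih =>
    have := ih p.2
    simp only [List.cons_append, chainCost]; linarith

theorem chainCost_concat (L : List (X × X)) (p : X × X) (s t : X) :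
    chainCost d (L ++ [p]) s t = chainCost d L s p.1 + d p.2 t := by
  induction L generalizing s with
  | nil => rfl
  | cons q L ih => simp only [List.cons_append, chainCost, ih]; ring

theorem chainCost_reverse (h2 : ∀ s t, d s t = d t s) (L : List (X × X)) (s t : X) :
    chainCost d (L.map Prod.swap).reverse t s = chainCost d L s t := by
  induction L generalizing s with
  | nil => exact h2 t s
  | cons p L ih =>
    simp only [List.map_cons, List.reverse_cons, chainCost_concat, chainCost, Prod.fst_swap,
      Prod.snd_swap, ih, h2 p.1 s]
    ring

theorem bddBelow_chainCost (h0 : ∀ s t, 0 ≤ d s t) (s t : X) :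
    BddBelow (Set.range fun L : {L : List (X × X) // ∀ p ∈ L, R p.1 p.2 ∨ R p.2 p.1} =>
      chainCost d L.1 s t) :=
  ⟨0, by rintro _ ⟨L, rfl⟩; exact chainCost_nonneg d h0 L.1 s t⟩

instance : Nonempty {L : List (X × X) // ∀ p ∈ L, R p.1 p.2 ∨ R p.2 p.1} :=
  ⟨⟨[], by simp⟩⟩

theorem quotDist_nonneg (h0 : ∀ s t, 0 ≤ d s t) (s t : X) : 0 ≤ quotDist d R s t :=
  le_ciInf fun L => chainCost_nonneg d h0 L.1 s t

theorem quotDist_le (h0 : ∀ s t, 0 ≤ d s t) (s t : X) : quotDist d R s t ≤ d s t :=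
  ciInf_le (bddBelow_chainCost d R h0 s t) ⟨[], by simp⟩

theorem quotDist_comm (h0 : ∀ s t, 0 ≤ d s t) (h2 : ∀ s t, d s t = d t s) (s t : X) :
    quotDist d R s t = quotDist d R t s := by
  have key : ∀ s t, quotDist d R s t ≤ quotDist d R t s := by
    intro s t
    refine le_ciInf fun L => ?_
    rw [← chainCost_reverse d h2]
    refine ciInf_le (bddBelow_chainCost d R h0 s t) ⟨(L.1.map Prod.swap).reverse, ?_⟩
    intro p hp
    rw [List.mem_reverse, List.mem_map] at hp
    obtain ⟨q, hq, rfl⟩ := hp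
    exact (L.2 q hq).symm
  exact le_antisymm (key s t) (key t s)

theorem quotDist_triangle (h0 : ∀ s t, 0 ≤ d s t) (h3 : ∀ s t u, d s u ≤ d s t + d t u)
    (s t u : X) : quotDist d R s u ≤ quotDist d R s t + quotDist d R t u := by
  refine le_ciInf_add_ciInf fun L K => ?_
  refine (ciInf_le (bddBelow_chainCost d R h0 s u) ⟨L.1 ++ K.1, ?_⟩).trans
    (chainCost_append d h3 L.1 K.1 s t u)
  intro p hp
  rcases List.mem_append.1 hp with hp | hp
  · exact L.2 p hp
  · exact K.2 p hp

end QuotDist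

/-- The pseudodistance on `[0, l]` of the tree coded by `h` with the shortcuts given by `g`
and `Q`. -/
def gluedDist (h g : ContPath) (l : ℝ≥0) (Q : Set (ℝ≥0 × ℝ≥0)) (s t : Set.Icc (0 : ℝ≥0) l) : ℝ :=
  quotDist (fun s t : Set.Icc (0 : ℝ≥0) l => treeDist h s t) (Shortcut g l Q) s t

theorem gluedDist_le (h g : ContPath) (l : ℝ≥0) (Q : Set (ℝ≥0 × ℝ≥0))
    (s t : Set.Icc (0 : ℝ≥0) l) : gluedDist h g l Q s t ≤ treeDist h s t :=
  quotDist_le (fun s t : Set.Icc (0 : ℝ≥0) l => treeDist h s t) _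
    (fun _ _ => treeDist_nonneg _ _ _) s t

theorem gluedDist_self (h g : ContPath) (l : ℝ≥0) (Q : Set (ℝ≥0 × ℝ≥0))
    (s : Set.Icc (0 : ℝ≥0) l) : gluedDist h g l Q s s = 0 :=
  le_antisymm ((gluedDist_le h g l Q s s).trans_eq (treeDist_self h s))
    (quotDist_nonneg _ _ (fun _ _ => treeDist_nonneg _ _ _) s s)

/-- The interval `[0, l]`, endowed with the pseudometric `gluedDist h g l Q`. -/
structure GluedInterval (h g : ContPath) (l : ℝ≥0) (Q : Set (ℝ≥0 × ℝ≥0)) : Type where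
  pt : Set.Icc (0 : ℝ≥0) l

instance (h g : ContPath) (l : ℝ≥0) (Q : Set (ℝ≥0 × ℝ≥0)) :
    PseudoMetricSpace (GluedInterval h g l Q) where
  dist s t := gluedDist h g l Q s.pt t.pt
  dist_self s := gluedDist_self h g l Q s.pt
  dist_comm s t := quotDist_comm (fun s t : Set.Icc (0 : ℝ≥0) l => treeDist h s t) _
    (fun _ _ => treeDist_nonneg _ _ _) (fun _ _ => treeDist_comm _ _ _) s.pt t.pt
  dist_triangle s t u := quotDist_triangle (fun s t : Set.Icc (0 : ℝ≥0) l => treeDist h s t) _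
    (fun _ _ => treeDist_nonneg _ _ _) (fun _ _ _ => treeDist_triangle _ _ _ _) s.pt t.pt u.pt

/-- The projection from `[0, l]` onto the quotient metric space. -/
def gluedProj (h g : ContPath) (l : ℝ≥0) (Q : Set (ℝ≥0 × ℝ≥0)) (s : Set.Icc (0 : ℝ≥0) l) :
    SeparationQuotient (GluedInterval h g l Q) :=
  SeparationQuotient.mk ⟨s⟩

theorem treeDist_le (h : ContPath) (s t : ℝ≥0) (ε : ℝ) (hε : ∀ u ∈ Set.uIcc s t, |h u - h s| ≤ ε) :
    treeDist h s t ≤ 3 * ε := by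
  have h1 : h s - ε ≤ sInf (h '' Set.uIcc s t) := by
    refine le_csInf (Set.nonempty_uIcc.image h) ?_
    rintro _ ⟨u, hu, rfl⟩
    linarith [neg_abs_le (h u - h s), hε u hu]
  have h2 := (le_abs_self _).trans (hε t Set.right_mem_uIcc)
  unfold treeDist; linarith

theorem continuous_gluedProj (h g : ContPath) (l : ℝ≥0) (Q : Set (ℝ≥0 × ℝ≥0)) :
    Continuous (gluedProj h g l Q) := by
  refine SeparationQuotient.continuous_mk.comp (?_ : Continuous (GluedInterval.mk (h := h) (g := g)
    (Q := Q)))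
  refine Metric.continuous_iff.2 fun s ε hε => ?_
  obtain ⟨δ, hδ, hs⟩ := Metric.continuous_iff.1 h.continuous s (ε / 4) (by positivity)
  refine ⟨δ, hδ, fun t ht => ?_⟩
  rw [dist_comm]
  refine (gluedDist_le h g l Q s t).trans_lt
    ((treeDist_le h s t (ε / 4) fun u hu => (hs u ?_).le).trans_lt (by linarith))
  refine lt_of_le_of_lt ?_ (show dist (t : ℝ≥0) s < δ from ht)
  rw [NNReal.dist_eq, NNReal.dist_eq]
  refine Set.abs_sub_left_of_mem_uIcc ?_
  rcases Set.mem_uIcc.1 hu with h | h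
  · exact Set.mem_uIcc.2 (Or.inl ⟨NNReal.coe_le_coe.2 h.1, NNReal.coe_le_coe.2 h.2⟩)
  · exact Set.mem_uIcc.2 (Or.inr ⟨NNReal.coe_le_coe.2 h.1, NNReal.coe_le_coe.2 h.2⟩)

theorem surjective_gluedProj (h g : ContPath) (l : ℝ≥0) (Q : Set (ℝ≥0 × ℝ≥0)) :
    Function.Surjective (gluedProj h g l Q) := by
  intro x
  obtain ⟨⟨s⟩, rfl⟩ := SeparationQuotient.surjective_mk x
  exact ⟨s, rfl⟩

instance (l : ℝ≥0) : IsFiniteMeasure (lebesgueNN.comap (Subtype.val : Set.Icc (0 : ℝ≥0) l → ℝ≥0)) :=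
  ⟨by
    rw [(MeasurableEmbedding.subtype_coe measurableSet_Icc).comap_apply]
    rw [Set.image_univ, Subtype.range_coe]
    exact lebesgueNN_Icc_lt_top l⟩

/-- The measured metric space `𝒢(h, g, Q)` for paths `h`, `g` of length `l`: the real tree coded
by `h`, in which `x` and `r(x, y)` are identified for all points `(x, y)` of `Q` under the graph
of `g`, with the push-forward of Lebesgue measure on `[0, l]`. The quotient of `[0, l]` by the
zero-distance relation of `quotDist` is the quotient of the tree `[0, l] / {d_h = 0}` by the
identifications. -/
def shortcutSpace (h g : ContPath) (l : ℝ≥0) (Q : Set (ℝ≥0 × ℝ≥0)) : MMSpace :=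
  letI : MeasurableSpace (SeparationQuotient (GluedInterval h g l Q)) := borel _
  { carrier := SeparationQuotient (GluedInterval h g l Q)
    compact := (surjective_gluedProj h g l Q).compactSpace (continuous_gluedProj h g l Q)
    nonempty := ⟨gluedProj h g l Q ⟨0, le_rfl, zero_le⟩⟩
    borel := ⟨rfl⟩
    μ := (lebesgueNN.comap (Subtype.val : Set.Icc (0 : ℝ≥0) l → ℝ≥0)).map (gluedProj h g l Q) }

/-! ### Excursions of the reflected Brownian motion with parabolic drift -/

/-- The path `κ w(s) + λ s - σ s² / 2`. -/
def parabolicPath (κ σ lam : ℝ) (w : ℝ≥0 → ℝ) (s : ℝ≥0) : ℝ :=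
  κ * w s + lam * s - σ * (s : ℝ) ^ 2 / 2

/-- The reflected path `w(s) - min_{u ≤ s} w(u)`. -/
def reflectedPath (w : ℝ≥0 → ℝ) (s : ℝ≥0) : ℝ :=
  w s - sInf (w '' Set.Icc 0 s)

/-- The intervals `(a, b)` of the excursions of `f` above `0`. -/
def excursionIntervals (f : ℝ≥0 → ℝ) : Set (ℝ≥0 × ℝ≥0) :=
  {p | p.1 < p.2 ∧ f p.1 = 0 ∧ f p.2 = 0 ∧ ∀ t ∈ Set.Ioo p.1 p.2, 0 < f t}

/-- The length of the `i`-th longest excursion of `f` (with `i = 0` for the longest one): the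
largest `x` such that at least `i + 1` excursions have length at least `x`. -/
def rankedLength (f : ℝ≥0 → ℝ) (i : ℕ) : ℝ≥0 :=
  sSup {x | 0 < x ∧ ((i + 1 : ℕ) : ℕ∞) ≤ {p ∈ excursionIntervals f | x ≤ p.2 - p.1}.encard}

/-! ### Tilted Brownian excursions -/

/-- `ν` is the law of the Brownian excursion of length `l` (continued by `0` after time `l`), that
is, of the Euclidean norm of a three-dimensional Brownian bridge of duration `l` from `0` to `0`,
the bridge being `B(t) - (t / l) B(l)` for a Brownian motion `B` with independent coordinates. -/
def IsExcursionLaw (l : ℝ≥0) (ν : Measure ContPath) : Prop :=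
  ∃ (Ω : Type) (_ : MeasurableSpace Ω) (P : Measure Ω) (B : Fin 3 → ℝ≥0 → Ω → ℝ)
    (e : Ω → ContPath),
    (∀ j, IsBrownianReal (B j) P) ∧
    iIndepFun (fun j ω t => B j t ω) P ∧
    (∀ᵐ ω ∂P, ∀ t, e ω t =
      if t ≤ l then √(∑ j, (B j t ω - (t / l : ℝ) * B j l ω) ^ 2) else 0) ∧
    HasLaw e ν P

/-- `ν` is the law of the tilted excursion: it has density proportional to `exp (θ ∫₀ˡ h)` with
respect to the law of the Brownian excursion of length `l`. -/
def IsTiltedExcursionLaw (θ : ℝ) (l : ℝ≥0) (ν : Measure ContPath) : Prop :=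
  ∃ ν₀, IsExcursionLaw l ν₀ ∧ ν = ν₀.tilted fun h => θ * ∫ s in Set.Icc 0 l, h s ∂lebesgueNN

/-! ### Poisson point processes -/

/-- Sets of points in `[0, ∞) × [0, ∞)`. -/
structure PointSet : Type where
  points : Set (ℝ≥0 × ℝ≥0)

/-- The number of points in `A`. -/
def PointSet.count (A : Set (ℝ≥0 × ℝ≥0)) (S : PointSet) : ℕ∞ :=
  (S.points ∩ A).encard

/-- The `σ`-algebra generated by the numbers of points in measurable sets. -/
instance : MeasurableSpace PointSet :=
  ⨆ A : {A : Set (ℝ≥0 × ℝ≥0) // MeasurableSet A}, MeasurableSpace.comap (PointSet.count A.1) ⊤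

/-- `Q` is a rate one Poisson point process on `[0, ∞) × [0, ∞)`: the number of points in a set of
finite area is Poisson with mean the area, and disjoint sets have independent numbers. -/
structure IsPoissonPointProcess {Ω : Type*} [MeasurableSpace Ω] (P : Measure Ω)
    (Q : Ω → PointSet) : Prop where
  aemeasurable : AEMeasurable Q P
  poisson : ∀ A : Set (ℝ≥0 × ℝ≥0), MeasurableSet A → (lebesgueNN.prod lebesgueNN) A ≠ ∞ →
    HasLaw (fun ω => (Q ω).count A)
      ((poissonMeasure ((lebesgueNN.prod lebesgueNN) A).toNNReal).map (Nat.cast : ℕ → ℕ∞)) P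
  indep : ∀ (n : ℕ) (A : Fin n → Set (ℝ≥0 × ℝ≥0)), (∀ i, MeasurableSet (A i)) →
    Pairwise (Function.onFun Disjoint A) → iIndepFun (fun i ω => (Q ω).count (A i)) P

/-! ### The limit objects -/

/-- The ingredients of the limit objects on the probability space `(Ω, P)`. -/
structure LimitIngredients {Ω : Type*} [MeasurableSpace Ω] (P : Measure Ω) (κ σ lam θ : ℝ)
    (Z : ℕ → Ω → ℝ≥0) (h : ℕ → Ω → ContPath) (Q : ℕ → Ω → PointSet) : Prop where
  /-- `Z` lists the excursion lengths of the reflected process in decreasing order. -/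
  lengths : ∃ B : ℝ≥0 → Ω → ℝ, IsBrownianReal B P ∧ ∀ i, ∀ᵐ ω ∂P,
    Z i ω = rankedLength (reflectedPath (parabolicPath κ σ lam fun s => B s ω)) i
  aemeasurable_exc : ∀ i, AEMeasurable (h i) P
  /-- Conditionally on `Z`, the `h i` are independent, and `h i` is a tilted excursion of
  length `Z i`. -/
  excursions : ∃ ν : ℝ≥0 → Measure ContPath, (∀ l, 0 < l → IsTiltedExcursionLaw θ l (ν l)) ∧
    ∀ (n : ℕ) (A : Set (ℕ → ℝ≥0)) (C : ℕ → Set ContPath), MeasurableSet A →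
      (∀ i, MeasurableSet (C i)) →
      P {ω | (fun i => Z i ω) ∈ A ∧ ∀ i < n, h i ω ∈ C i} =
        ∫⁻ ω in {ω | (fun i => Z i ω) ∈ A}, ∏ i ∈ Finset.range n, ν (Z i ω) (C i) ∂P
  poisson : ∀ i, IsPoissonPointProcess P (Q i)
  indep_poisson : iIndepFun Q P
  indep : IndepFun (fun ω => ((fun i => Z i ω), (fun i => h i ω))) (fun ω i => Q i ω) P

/-- `M` is a version of the limit `(M₀(λ), M₁(λ), …)` for the rank-one model with parameters
`σ₁`, `σ₃`. -/
def IsRankOneLimit {Ω : Type*} [MeasurableSpace Ω] (P : Measure Ω) (σ₁ σ₃ lam : ℝ)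
    (M : ℕ → Ω → MMSpace) : Prop :=
  ∃ (Z : ℕ → Ω → ℝ≥0) (h : ℕ → Ω → ContPath) (Q : ℕ → Ω → PointSet),
    LimitIngredients P √(σ₃ / σ₁) (σ₃ / σ₁ ^ 2) lam (σ₃ ^ (1 / 2 : ℝ) / σ₁ ^ (3 / 2 : ℝ)) Z h Q ∧
    ∀ i, ∀ᵐ ω ∂P, M i ω =
      shortcutSpace ((2 * σ₁ ^ (1 / 2 : ℝ) / σ₃ ^ (1 / 2 : ℝ)) • h i ω)
        ((σ₃ ^ (1 / 2 : ℝ) / σ₁ ^ (3 / 2 : ℝ)) • h i ω) (Z i ω) (Q i ω).points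

/-- `M` is a version of the limit `(M₀(λ), M₁(λ), …)` for the critical Erdős–Rényi random graph. -/
def IsErdosRenyiLimit {Ω : Type*} [MeasurableSpace Ω] (P : Measure Ω) (lam : ℝ)
    (M : ℕ → Ω → MMSpace) : Prop :=
  ∃ (Z : ℕ → Ω → ℝ≥0) (h : ℕ → Ω → ContPath) (Q : ℕ → Ω → PointSet),
    LimitIngredients P 1 1 lam 1 Z h Q ∧
    ∀ i, ∀ᵐ ω ∂P, M i ω = shortcutSpace ((2 : ℝ) • h i ω) (h i ω) (Z i ω) (Q i ω).points

end

/-!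
The proof is Brownian scaling, carried through the construction of the limit objects. Put
`a = σ₁ / σ₃ ^ (1 / 3)`. If `Z`, `h`, `Q` are the ingredients of the rank-one limit, then
`Z / a`, the paths `u ↦ a ^ (-1 / 2) h(a u)` and the images of the points of `Q` under the area
preserving map `(x, y) ↦ (x / a, a y)` are ingredients of the Erdős–Rényi limit at
`λ σ₁ / σ₃ ^ (2 / 3)` (`LimitIngredients.scale`), and the space built from the old ingredients is
isometric, with its measure, to the rescaled space built from the new ones
(`shortcutSpace_mem_iff_scl`). It remains to see that the ingredients have only one law, and that
the space is a measurable function of them.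

*Uniqueness of the law* (`LimitIngredients.identDistrib`). The ranked excursion lengths are a
measurable function of the Brownian path (`measurable_rankedLength`), whose law on the space of
paths is determined by its finite-dimensional laws. The law of the tilted excursion of length `l` is
unique, and by scaling it depends measurably on `l` (`measurable_isTiltedExcursionLaw`), so that the
conditional description of the excursions determines the joint law of lengths and excursions. The
law of a Poisson point process is determined because the numbers of points in finitely many sets
are sums of the independent numbers of points in their disjoint atoms
(`IsPoissonPointProcess.map_eq`). Nothing is known about an excursion of length `0`; since all
spaces of length `0` are a point of mass `0`, such excursions are replaced by the zero path
(`eraseZero`), and no positivity of the lengths is needed.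

*Measurability* (`measurable_scl_shortcutSpace`). A tree with shortcuts is the image of `[0, 1]`
under a continuous map that carries a multiple of Lebesgue measure to its measure. Two spaces
parametrized in this way are at Gromov–Hausdorff–Prokhorov distance at most the uniform distance
between their pulled back metrics and the difference of their masses
(`MMSpace.ghpDist_le_of_isParam`). Hence the space is a continuous function of its mass and pulled
back metric, and only the measurability of single distances has to be checked; the triangle
inequality for the Gromov–Hausdorff–Prokhorov distance is not needed. A distance in the tree with
shortcuts is less than `c` if and only if there is a finite chain of shortcuts of length less than
`c`. This is an existential statement about the points of `Q`, which is measurable because the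
normalized counting measure of a locally finite set of points is a finite kernel
(`PointSet.measurableSet_exists_mem`).
-/

noncomputable section

/-! ### Parametrized spaces -/

namespace MMSpace

theorem tvDist_of_le {α : Type} [MeasurableSpace α] (μ ν : Measure α)
    [IsFiniteMeasure μ] [IsFiniteMeasure ν] (h : ν ≤ μ) :
    tvDist μ ν = (μ - ν) Set.univ := by
  have hs : μ.toSignedMeasure - ν.toSignedMeasure =
      (⟨μ - ν, 0, Measure.MutuallySingular.zero_right⟩ :
        JordanDecomposition α).toSignedMeasure := by
    rw [JordanDecomposition.toSignedMeasure]
    rw [Measure.toSignedMeasure_zero, sub_zero, sub_eq_iff_eq_add,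
      ← Measure.toSignedMeasure_add]
    exact Measure.toSignedMeasure_congr (Measure.sub_add_cancel_of_le h).symm
  rw [tvDist, SignedMeasure.totalVariation, SignedMeasure.toJordanDecomposition_eq hs]
  simp

theorem tvDist_smul {α : Type} [MeasurableSpace α] (ρ : Measure α) [IsProbabilityMeasure ρ]
    (μ ν : Measure α) [IsFiniteMeasure μ] [IsFiniteMeasure ν] (m n : ℝ≥0) (h : n ≤ m)
    (hμ : μ = m • ρ) (hν : ν = n • ρ) : tvDist μ ν = (m - n : ℝ≥0) := by
  subst hμ hν
  obtain ⟨k, rfl⟩ := exists_add_of_le h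
  rw [tvDist_of_le]
  · rw [add_smul, add_comm (n • ρ), Measure.add_sub_cancel, add_tsub_cancel_left]
    simp
  · rw [add_smul]
    exact Measure.le_add_right le_rfl

/-- `X` is parametrized by `p : [0, 1] → X` with mass `m`: the map `p` is onto and continuous, and
the measure of `X` is `m` times the image of Lebesgue measure. -/
structure IsParam (X : MMSpace) (m : ℝ≥0) (p : unitInterval → X.carrier) : Prop where
  continuous : Continuous p
  surjective : Function.Surjective p
  measure : X.μ = m • (volume : Measure unitInterval).map p

theorem IsParam.measurable {X : MMSpace} {m : ℝ≥0} {p : unitInterval → X.carrier}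
    (h : IsParam X m p) : Measurable p := h.continuous.measurable

/-- Two parametrized spaces are as close as their masses and pulled back distances. The witnesses
are the image of `[0, 1]` under the pair of parametrizations, as a correspondence, and the image of
the smaller multiple of Lebesgue measure, as a coupling. -/
theorem ghpDist_le_of_isParam {X Y : MMSpace} {m n : ℝ≥0} {p : unitInterval → X.carrier}
    {q : unitInterval → Y.carrier} (hp : IsParam X m p) (hq : IsParam Y n q) (ε : ℝ)
    (hd : ∀ s t, |dist (p s) (p t) - dist (q s) (q t)| ≤ ε) (hm : |(m : ℝ) - n| ≤ ε) :
    ghpDist X Y ≤ ENNReal.ofReal ε := by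
  set φ : unitInterval → X.carrier × Y.carrier := fun s => (p s, q s) with hφ
  have hφc : Continuous φ := hp.continuous.prodMk hq.continuous
  have hC : MeasurableSet (Set.range φ) := (isCompact_range hφc).isClosed.measurableSet
  have hcor : IsCorrespondence X Y (Set.range φ) := by
    refine ⟨hC, fun x => ?_, fun y => ?_⟩
    · obtain ⟨s, rfl⟩ := hp.surjective x
      exact ⟨q s, s, rfl⟩
    · obtain ⟨s, rfl⟩ := hq.surjective y
      exact ⟨p s, s, rfl⟩
  have hprob : IsProbabilityMeasure ((volume : Measure unitInterval).map φ) :=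
    Measure.isProbabilityMeasure_map hφc.measurable.aemeasurable
  have hpp : IsProbabilityMeasure ((volume : Measure unitInterval).map p) :=
    Measure.isProbabilityMeasure_map hp.measurable.aemeasurable
  have hqp : IsProbabilityMeasure ((volume : Measure unitInterval).map q) :=
    Measure.isProbabilityMeasure_map hq.measurable.aemeasurable
  set π : FiniteMeasure (X.carrier × Y.carrier) :=
    ⟨min m n • (volume : Measure unitInterval).map φ, inferInstance⟩ with hπ
  have hπc : (π : Measure (X.carrier × Y.carrier)) =
    min m n • (volume : Measure unitInterval).map φ := rfl
  refine iInf_le_of_le (Set.range φ) (iInf_le_of_le hcor (iInf_le_of_le π ?_))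
  refine max_le ?_ (max_le ?_ ?_)
  · refine (ENNReal.half_le_self).trans ?_
    refine iSup₂_le fun x hx => iSup₂_le fun y hy => ?_
    obtain ⟨s, rfl⟩ := hx
    obtain ⟨t, rfl⟩ := hy
    exact ENNReal.ofReal_le_ofReal (hd s t)
  · have h1 : (π : Measure (X.carrier × Y.carrier)).map Prod.fst =
        min m n • (volume : Measure unitInterval).map p := by
      rw [hπc, Measure.map_smul, Measure.map_map measurable_fst hφc.measurable]; rfl
    have h2 : (π : Measure (X.carrier × Y.carrier)).map Prod.snd =
        min m n • (volume : Measure unitInterval).map q := by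
      rw [hπc, Measure.map_smul, Measure.map_map measurable_snd hφc.measurable]; rfl
    rw [discrepancy, tvDist_smul _ _ _ m (min m n) (min_le_left _ _) hp.measure h1,
      tvDist_smul _ _ _ n (min m n) (min_le_right _ _) hq.measure h2, ← ENNReal.coe_add,
      ENNReal.ofReal, ENNReal.coe_le_coe, Real.le_toNNReal_iff_coe_le ((abs_nonneg _).trans hm)]
    refine le_trans (le_of_eq ?_) hm
    rcases le_total m n with h | h
    · have h' : (m : ℝ) ≤ n := h
      rw [min_eq_left h, tsub_self, zero_add, NNReal.coe_sub h, abs_of_nonpos (by linarith)]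
      ring
    · have h' : (n : ℝ) ≤ m := h
      rw [min_eq_right h, tsub_self, add_zero, NNReal.coe_sub h, abs_of_nonneg (by linarith)]
  · rw [hπc]
    have : ((volume : Measure unitInterval).map φ) (Set.range φ)ᶜ = 0 := by
      rw [Measure.map_apply hφc.measurable hC.compl]
      simp [Set.preimage_compl]
    rw [Measure.smul_apply, this]
    simp

/-- The pulled back distance, as a continuous function. -/
def paramDist {X : MMSpace} {p : unitInterval → X.carrier} (hp : Continuous p) :
    C(unitInterval × unitInterval, ℝ) :=
  ⟨fun x => dist (p x.1) (p x.2), by fun_prop⟩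

theorem _root_.measurable_of_measurableSet_closedBall {α E : Type*} [MeasurableSpace α]
    [PseudoMetricSpace E] [SecondCountableTopology E] [MeasurableSpace E] [BorelSpace E]
    {f : α → E}
    (h : ∀ c r, MeasurableSet {a | dist (f a) c ≤ r}) : Measurable f := by
  refine measurable_of_isOpen fun U hU => ?_
  rcases isEmpty_or_nonempty E with hE | hE
  · have : IsEmpty α := ⟨fun a => hE.elim (f a)⟩
    simp [Set.eq_empty_of_isEmpty]
  have key : f ⁻¹' U = ⋃ k : ℕ, ⋃ j : ℕ, ⋃ (_ : Metric.closedBall (TopologicalSpace.denseSeq E k)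
      (1 / (j + 1 : ℝ)) ⊆ U), {a | dist (f a) (TopologicalSpace.denseSeq E k) ≤ 1 / (j + 1 : ℝ)} := by
    ext a
    simp only [Set.mem_preimage, Set.mem_iUnion, Set.mem_ofPred_eq, exists_prop]
    constructor
    · intro ha
      obtain ⟨ε, hε, hb⟩ := Metric.isOpen_iff.1 hU _ ha
      obtain ⟨j, hj⟩ := exists_nat_one_div_lt (half_pos hε)
      obtain ⟨k, hk⟩ := (TopologicalSpace.denseRange_denseSeq E).exists_dist_lt (f a)
        (Nat.one_div_pos_of_nat (α := ℝ) (n := j))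
      refine ⟨k, j, fun y hy => hb ?_, hk.le⟩
      rw [Metric.mem_closedBall, dist_comm] at hy
      rw [Metric.mem_ball, dist_comm]
      linarith [dist_triangle (f a) (TopologicalSpace.denseSeq E k) y]
    · rintro ⟨k, j, hs, ha⟩
      exact hs ha
  rw [key]
  exact MeasurableSet.iUnion fun k => MeasurableSet.iUnion fun j => MeasurableSet.iUnion fun _ =>
    h _ _

theorem _root_.ContinuousMap.measurable_of_eval {α K : Type*} [MeasurableSpace α]
    [TopologicalSpace K] [CompactSpace K] [SecondCountableTopology K] [Nonempty K]
    [LocallyCompactSpace K]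
    [MeasurableSpace C(K, ℝ)] [BorelSpace C(K, ℝ)]
    {f : α → C(K, ℝ)} (h : ∀ x, Measurable fun a => f a x) : Measurable f := by
  refine measurable_of_measurableSet_closedBall fun c r => ?_
  rcases lt_or_ge r 0 with hr | hr
  · convert MeasurableSet.empty
    ext a
    simpa using hr.trans_le dist_nonneg
  obtain ⟨D, hDc, hD⟩ := TopologicalSpace.exists_countable_dense K
  have : {a | dist (f a) c ≤ r} = ⋂ x ∈ D, {a | dist (f a x) (c x) ≤ r} := by
    ext a
    simp only [Set.mem_ofPred_eq, Set.mem_iInter]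
    rw [ContinuousMap.dist_le hr]
    refine ⟨fun h x _ => h x, fun h x => ?_⟩
    exact hD.induction (P := fun x => dist (f a x) (c x) ≤ r) h
      (isClosed_le (by fun_prop) continuous_const) x
  rw [this]
  exact MeasurableSet.biInter hDc fun x _ =>
    measurableSet_le ((h x).dist measurable_const) measurable_const

/-- A family of parametrized spaces is measurable as soon as the masses and the pulled back
distances are: these data determine the space through a map which is continuous for the uniform
distance, by `ghpDist_le_of_isParam`. -/
theorem measurable_of_isParam {α : Type*} [MeasurableSpace α] {X : α → MMSpace} {m : α → ℝ≥0}
    {p : ∀ a, unitInterval → (X a).carrier} (hp : ∀ a, IsParam (X a) (m a) (p a))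
    (hm : Measurable m) (hd : ∀ s t, Measurable fun a => dist (p a s) (p a t)) :
    Measurable X := by
  refine measurable_of_isOpen fun U hU => ?_
  let _ : MeasurableSpace C(unitInterval × unitInterval, ℝ) := _root_.borel _
  have _ : BorelSpace C(unitInterval × unitInterval, ℝ) := ⟨rfl⟩
  set code : α → ℝ × C(unitInterval × unitInterval, ℝ) :=
    fun a => (m a, paramDist (hp a).continuous) with hcode
  have hcm : Measurable code := by
    refine Measurable.prodMk hm.coe_nnreal_real ?_
    exact ContinuousMap.measurable_of_eval fun x => hd x.1 x.2
  let V : Set (ℝ × C(unitInterval × unitInterval, ℝ)) :=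
    {c | ∃ a, ∃ ε : ℝ, 0 < ε ∧ (∀ Y, ghpDist (X a) Y < ENNReal.ofReal ε → Y ∈ U) ∧
      dist (code a) c < ε}
  have hV : IsOpen V := by
    have : V = ⋃ (a) (ε : ℝ) (_ : 0 < ε ∧ ∀ Y, ghpDist (X a) Y < ENNReal.ofReal ε → Y ∈ U),
        Metric.ball (code a) ε := by
      ext c
      simp only [V, Set.mem_ofPred_eq, Set.mem_iUnion, Metric.mem_ball, exists_prop, and_assoc,
        dist_comm c]
    rw [this]
    exact isOpen_iUnion fun a => isOpen_iUnion fun ε => isOpen_iUnion fun _ => Metric.isOpen_ball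
  have : X ⁻¹' U = code ⁻¹' V := by
    ext a
    constructor
    · intro ha
      obtain ⟨ε, hε, h⟩ := hU (X a) ha
      have h1 : 0 < min ε 1 := lt_min hε one_pos
      have h2 : min ε 1 ≠ ∞ := ne_top_of_le_ne_top ENNReal.one_ne_top (min_le_right _ _)
      refine ⟨a, (min ε 1).toReal, ENNReal.toReal_pos h1.ne' h2, fun Y hY => h Y ?_, ?_⟩
      · rw [ENNReal.ofReal_toReal h2] at hY
        exact hY.trans_le (min_le_left _ _)
      · rw [dist_self]
        exact ENNReal.toReal_pos h1.ne' h2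
    · rintro ⟨b, ε, hε, h, hba⟩
      refine h (X a) ?_
      refine (ghpDist_le_of_isParam (hp b) (hp a) (dist (code b) (code a)) ?_ ?_).trans_lt
        ((ENNReal.ofReal_lt_ofReal_iff hε).2 hba)
      · intro s t
        refine le_trans ?_ (le_max_right _ _)
        exact ContinuousMap.dist_apply_le_dist (f := (code b).2) (g := (code a).2) (s, t)
      · exact le_max_left (dist (code b).1 (code a).1) _
  rw [this]
  exact hcm hV.measurableSet

/-- Spaces with the same parametrization data belong to the same measurable sets. -/
theorem mem_iff_of_isParam {X Y : MMSpace} {m : ℝ≥0} {p : unitInterval → X.carrier}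
    {q : unitInterval → Y.carrier} (hp : IsParam X m p) (hq : IsParam Y m q)
    (hd : ∀ s t, dist (p s) (p t) = dist (q s) (q t)) {S : Set MMSpace} (hS : MeasurableSet S) :
    X ∈ S ↔ Y ∈ S := by
  induction S, hS using MeasurableSpace.generateFrom_induction with
  | hC U hU _ =>
    have h0 : ghpDist X Y = 0 := by
      simpa using ghpDist_le_of_isParam hp hq 0 (by simp [hd]) (by simp)
    have h1 : ghpDist Y X = 0 := by
      simpa using ghpDist_le_of_isParam hq hp 0 (by simp [hd]) (by simp)
    constructor
    · intro h
      obtain ⟨ε, hε, h⟩ := hU X h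
      exact h Y (h0 ▸ hε)
    · intro h
      obtain ⟨ε, hε, h⟩ := hU Y h
      exact h X (h1 ▸ hε)
  | empty => simp
  | compl t _ h => simp [h]
  | iUnion f _ h => simp [h]

end MMSpace

/-! ### Measurability of the glued distance -/

section Paths

variable {α : Type*} [MeasurableSpace α]

theorem ContPath.measurable_coe : Measurable fun h : ContPath => (h : ℝ≥0 → ℝ) :=
  comap_measurable _

theorem ContPath.measurable_iff {f : α → ContPath} :
    Measurable f ↔ ∀ t, Measurable fun a => f a t := by
  rw [measurable_comap_iff, measurable_pi_iff]; rfl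

theorem ContPath.measurable_uncurry : Measurable fun x : ContPath × ℝ≥0 => x.1 x.2 := by
  have : Measurable (Function.uncurry fun (t : ℝ≥0) (h : ContPath) => h t) :=
    measurable_uncurry_of_continuous_of_measurable (fun h => h.continuous)
      fun t => (measurable_pi_apply t).comp ContPath.measurable_coe
  exact this.comp measurable_swap

theorem ContPath.measurable_apply {h : α → ContPath} {t : α → ℝ≥0} (hh : Measurable h)
    (ht : Measurable t) : Measurable fun a => h a (t a) :=
  ContPath.measurable_uncurry.comp (hh.prodMk ht)

theorem ContPath.measurable_smul {f : α → ContPath} (c : ℝ) (hf : Measurable f) :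
    Measurable fun a => c • f a :=
  ContPath.measurable_iff.2 fun t => ((ContPath.measurable_iff.1 hf) t).const_mul c

theorem sInf_image_uIcc_lt_iff (h : ContPath) (s t : ℝ≥0) (c : ℝ) :
    sInf (h '' Set.uIcc s t) < c ↔ ∃ k : ℕ,
      h (max (min s t) (min (max s t) (TopologicalSpace.denseSeq ℝ≥0 k))) < c := by
  have hmem : ∀ r, max (min s t) (min (max s t) r) ∈ Set.uIcc s t := fun r =>
    ⟨le_max_left _ _, max_le min_le_max (min_le_left _ _)⟩
  constructor
  · intro hc
    obtain ⟨_, ⟨u, hu, rfl⟩, huc⟩ := exists_lt_of_csInf_lt (Set.nonempty_uIcc.image h) hc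
    have hu' : max (min s t) (min (max s t) u) = u := by
      rw [min_eq_right hu.2]
      exact max_eq_right hu.1
    have ho : IsOpen {r | h (max (min s t) (min (max s t) r)) < c} :=
      isOpen_lt (by fun_prop) continuous_const
    obtain ⟨k, hk⟩ := (TopologicalSpace.denseRange_denseSeq ℝ≥0).exists_mem_open ho
      ⟨u, by rw [Set.mem_ofPred_eq, hu']; exact huc⟩
    exact ⟨k, hk⟩
  · rintro ⟨k, hk⟩
    exact (sInf_uIcc_le h (hmem _)).trans_lt hk

theorem measurable_sInf_image_uIcc {h : α → ContPath} {s t : α → ℝ≥0} (hh : Measurable h)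
    (hs : Measurable s) (ht : Measurable t) :
    Measurable fun a => sInf (h a '' Set.uIcc (s a) (t a)) := by
  refine measurable_of_Iio fun c => ?_
  have : (fun a => sInf (h a '' Set.uIcc (s a) (t a))) ⁻¹' Set.Iio c = ⋃ k : ℕ,
      {a | h a (max (min (s a) (t a)) (min (max (s a) (t a))
        (TopologicalSpace.denseSeq ℝ≥0 k))) < c} := by
    ext a
    simp only [Set.mem_preimage, Set.mem_Iio, Set.mem_iUnion, Set.mem_ofPred_eq,
      sInf_image_uIcc_lt_iff]
  rw [this]
  exact MeasurableSet.iUnion fun k => measurableSet_lt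
    (ContPath.measurable_apply hh (by fun_prop)) measurable_const

theorem measurable_treeDist {h : α → ContPath} {s t : α → ℝ≥0} (hh : Measurable h)
    (hs : Measurable s) (ht : Measurable t) : Measurable fun a => treeDist (h a) (s a) (t a) :=
  ((ContPath.measurable_apply hh hs).add (ContPath.measurable_apply hh ht)).sub
    ((measurable_sInf_image_uIcc hh hs ht).const_mul 2)

theorem exists_le_iff_sInf_image_le (g : ContPath) {x c : ℝ≥0} (hxc : x ≤ c) (y : ℝ) :
    (∃ x', x ≤ x' ∧ x' ≤ c ∧ g x' ≤ y) ↔ sInf (g '' Set.uIcc x c) ≤ y := by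
  constructor
  · rintro ⟨x', h1, h2, h3⟩
    exact (sInf_uIcc_le g (by rw [Set.uIcc_of_le hxc]; exact ⟨h1, h2⟩)).trans h3
  · intro hy
    obtain ⟨x', h1, h2⟩ := (isCompact_uIcc.image g.continuous).sInf_mem
      (Set.nonempty_uIcc (a := x) (b := c).image g)
    rw [Set.uIcc_of_le hxc] at h1
    exact ⟨x', h1.1, h1.2, h2 ▸ hy⟩

theorem isClosed_shortcutEnd_set (g : ContPath) (x y : ℝ≥0) :
    IsClosed {x' | x ≤ x' ∧ g x' ≤ y} :=
  (isClosed_le continuous_const continuous_id).inter (isClosed_le g.continuous continuous_const)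

/-- The second alternative is that `g` stays above `y` after `x`: then the infimum is that of the
empty set, which is `0`. -/
theorem shortcutEnd_le_iff (g : ContPath) (x y c : ℝ≥0) :
    shortcutEnd g x y ≤ c ↔ (x ≤ c ∧ sInf (g '' Set.uIcc x c) ≤ y) ∨
      ∀ n : ℕ, ¬ sInf (g '' Set.uIcc x (x + n)) ≤ y := by
  rcases Set.eq_empty_or_nonempty {x' | x ≤ x' ∧ g x' ≤ y} with he | hne
  · have h1 : shortcutEnd g x y = 0 := by rw [shortcutEnd, he]; exact NNReal.sInf_empty
    rw [h1]
    refine iff_of_true zero_le (Or.inr fun n hn => ?_)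
    obtain ⟨x', h1, _, h3⟩ := (exists_le_iff_sInf_image_le g (le_self_add : x ≤ x + n) y).2 hn
    exact Set.eq_empty_iff_forall_notMem.1 he x' (And.intro h1 h3)
  · have hmem := (isClosed_shortcutEnd_set g x y).csInf_mem hne (OrderBot.bddBelow _)
    have hnot : ¬ ∀ n : ℕ, ¬ sInf (g '' Set.uIcc x (x + n)) ≤ y := by
      push Not
      obtain ⟨n, hn⟩ := exists_nat_ge (shortcutEnd g x y)
      exact ⟨n, (exists_le_iff_sInf_image_le g le_self_add y).1
        ⟨_, hmem.1, hn.trans le_add_self, hmem.2⟩⟩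
    rw [or_iff_left hnot]
    constructor
    · intro hc
      have hxc := hmem.1.trans hc
      exact ⟨hxc, (exists_le_iff_sInf_image_le g hxc y).1 ⟨_, hmem.1, hc, hmem.2⟩⟩
    · rintro ⟨hxc, h⟩
      obtain ⟨x', h1, h2, h3⟩ := (exists_le_iff_sInf_image_le g hxc y).2 h
      exact (csInf_le (OrderBot.bddBelow {x' | x ≤ x' ∧ g x' ≤ y}) (And.intro h1 h3)).trans h2

theorem measurable_shortcutEnd {g : α → ContPath} {x y : α → ℝ≥0} (hg : Measurable g)
    (hx : Measurable x) (hy : Measurable y) :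
    Measurable fun a => shortcutEnd (g a) (x a) (y a) := by
  refine measurable_of_Iic fun c => ?_
  have : (fun a => shortcutEnd (g a) (x a) (y a)) ⁻¹' Set.Iic c =
      ({a | x a ≤ c} ∩ {a | sInf (g a '' Set.uIcc (x a) c) ≤ y a}) ∪
      ⋂ n : ℕ, {a | sInf (g a '' Set.uIcc (x a) (x a + n)) ≤ y a}ᶜ := by
    ext a
    simp only [Set.mem_preimage, Set.mem_Iic, shortcutEnd_le_iff, Set.mem_union, Set.mem_inter_iff,
      Set.mem_ofPred_eq, Set.mem_iInter, Set.mem_compl_iff]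
  rw [this]
  refine ((measurableSet_le hx measurable_const).inter (measurableSet_le
    (measurable_sInf_image_uIcc hg hx measurable_const) hy.coe_nnreal_real)).union
    (MeasurableSet.iInter fun n => (measurableSet_le
    (measurable_sInf_image_uIcc hg hx (hx.add_const _)) hy.coe_nnreal_real).compl)

end Paths

namespace PointSet

theorem measurable_count {A : Set (ℝ≥0 × ℝ≥0)} (hA : MeasurableSet A) :
    Measurable (PointSet.count A) := by
  refine Measurable.mono (comap_measurable (m := ⊤) (PointSet.count A)) ?_ le_top
  exact le_iSup (fun A : {A : Set (ℝ≥0 × ℝ≥0) // MeasurableSet A} =>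
    MeasurableSpace.comap (PointSet.count A.1) ⊤) ⟨A, hA⟩

/-- The square `[0, n] × [0, n]`. -/
def square (n : ℕ) : Set (ℝ≥0 × ℝ≥0) := Set.Icc 0 (n : ℝ≥0) ×ˢ Set.Icc 0 (n : ℝ≥0)

theorem measurableSet_square (n : ℕ) : MeasurableSet (square n) :=
  measurableSet_Icc.prod measurableSet_Icc

theorem exists_mem_square (q : ℝ≥0 × ℝ≥0) : ∃ n, q ∈ square n := by
  obtain ⟨n, hn⟩ := exists_nat_ge (max q.1 q.2)
  exact ⟨n, ⟨zero_le, (le_max_left _ _).trans hn⟩, ⟨zero_le, (le_max_right _ _).trans hn⟩⟩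

/-- A set of points is locally finite if it has finitely many points in every square. -/
def LocallyFinite (S : PointSet) : Prop := ∀ n, PointSet.count (square n) S ≠ ⊤

theorem measurableSet_locallyFinite : MeasurableSet {S : PointSet | S.LocallyFinite} := by
  have : {S : PointSet | S.LocallyFinite} = ⋂ n, PointSet.count (square n) ⁻¹' {⊤}ᶜ := by
    ext S; simp [LocallyFinite]
  rw [this]
  exact MeasurableSet.iInter fun n => measurable_count (measurableSet_square n)
    (MeasurableSet.of_discrete)

open Classical in
/-- The normalized counting measure of the points of `S` in the `n`-th square, which is `0` if
there are infinitely many of them. -/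
def squareMeasure (n : ℕ) (S : PointSet) : Measure (ℝ≥0 × ℝ≥0) :=
  if PointSet.count (square n) S ≠ ⊤ then
    ((PointSet.count (square n) S : ℕ∞) : ℝ≥0∞)⁻¹ • Measure.count.restrict (S.points ∩ square n)
  else 0

theorem squareMeasure_apply {n : ℕ} {S : PointSet} (h : PointSet.count (square n) S ≠ ⊤)
    {A : Set (ℝ≥0 × ℝ≥0)} (hA : MeasurableSet A) :
    squareMeasure n S A = ((PointSet.count (square n) S : ℕ∞) : ℝ≥0∞)⁻¹ *
      (PointSet.count (A ∩ square n) S : ℕ∞) := by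
  have hfin : (S.points ∩ square n).Finite := Set.encard_ne_top_iff.1 h
  rw [squareMeasure, if_pos h, Measure.smul_apply, Measure.restrict_apply hA,
    Measure.count_apply (hA.inter hfin.measurableSet), smul_eq_mul, PointSet.count, PointSet.count,
    Set.inter_left_comm]

/-- The normalized counting measure of the points in a square, as a kernel. -/
def squareKernel (n : ℕ) : Kernel PointSet (ℝ≥0 × ℝ≥0) where
  toFun := squareMeasure n
  measurable' := by
    refine Measure.measurable_of_measurable_coe _ fun A hA => ?_
    have : (fun S => squareMeasure n S A) = fun S =>
        if PointSet.count (square n) S ≠ ⊤ then ((PointSet.count (square n) S : ℕ∞) : ℝ≥0∞)⁻¹ *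
          ((PointSet.count (A ∩ square n) S : ℕ∞) : ℝ≥0∞) else 0 := by
      ext S
      split_ifs with h
      · exact squareMeasure_apply h hA
      · rw [squareMeasure, if_neg h]; rfl
    rw [this]
    have hc := measurable_count (measurableSet_square n)
    have hc' := measurable_count (hA.inter (measurableSet_square n))
    refine Measurable.ite (hc (MeasurableSet.of_discrete (s := {⊤}ᶜ))) ?_ measurable_const
    exact (Measurable.of_discrete.comp hc).inv.mul (Measurable.of_discrete.comp hc')

instance (n : ℕ) : IsFiniteKernel (squareKernel n) := by
  refine ⟨1, ENNReal.one_lt_top, fun S => ?_⟩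
  change squareMeasure n S Set.univ ≤ 1
  by_cases h : PointSet.count (square n) S ≠ ⊤
  · rw [squareMeasure_apply h MeasurableSet.univ, Set.univ_inter]
    exact ENNReal.inv_mul_le_one _
  · rw [squareMeasure, if_neg h]; simp

theorem squareMeasure_ne_zero_iff {n : ℕ} {S : PointSet} (h : S.LocallyFinite)
    {A : Set (ℝ≥0 × ℝ≥0)} (hA : MeasurableSet A) :
    squareMeasure n S A ≠ 0 ↔ ∃ q ∈ S.points, q ∈ square n ∧ q ∈ A := by
  rw [squareMeasure_apply (h n) hA, mul_ne_zero_iff, ENNReal.inv_ne_zero]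
  rw [and_iff_right (by simpa using h n), ne_eq, ENat.toENNReal_eq_zero, PointSet.count,
    Set.encard_eq_zero, ← ne_eq, ← Set.nonempty_iff_ne_empty]
  exact ⟨fun ⟨q, hq⟩ => ⟨q, hq.1, hq.2.2, hq.2.1⟩, fun ⟨q, h1, h2, h3⟩ => ⟨q, h1, h3, h2⟩⟩

/-- Measurability of the existence of a point of a random set with a measurable property. It is
derived from the measurability of the measure of sections with respect to a kernel. -/
theorem measurableSet_exists_mem {α : Type*} [MeasurableSpace α] {Q : α → PointSet}
    (hQ : Measurable Q) (hl : ∀ a, (Q a).LocallyFinite) {T : Set (α × (ℝ≥0 × ℝ≥0))}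
    (hT : MeasurableSet T) : MeasurableSet {a | ∃ q ∈ (Q a).points, (a, q) ∈ T} := by
  have : {a | ∃ q ∈ (Q a).points, (a, q) ∈ T} = ⋃ n,
      (fun a => (squareKernel n).comap Q hQ a (Prod.mk a ⁻¹' T)) ⁻¹' {0}ᶜ := by
    ext a
    simp only [Set.mem_ofPred_eq, Set.mem_iUnion, Set.mem_preimage, Set.mem_compl_iff,
      Set.mem_singleton_iff, Kernel.comap_apply]
    have h1 (n : ℕ) := squareMeasure_ne_zero_iff (n := n) (hl a) (measurable_prodMk_left (x := a) hT)
    constructor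
    · rintro ⟨q, hq, hqT⟩
      obtain ⟨n, hn⟩ := exists_mem_square q
      exact ⟨n, (h1 n).2 ⟨q, hq, hn, hqT⟩⟩
    · rintro ⟨n, hn⟩
      obtain ⟨q, hq, _, hqT⟩ := (h1 n).1 hn
      exact ⟨q, hq, hqT⟩
  rw [this]
  exact MeasurableSet.iUnion fun n =>
    Kernel.measurable_kernel_prodMk_left hT (MeasurableSet.singleton 0).compl

open Classical in
/-- The set `S` if it is locally finite, and the empty set otherwise. -/
def regularize (S : PointSet) : PointSet := if S.LocallyFinite then S else ⟨∅⟩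

theorem locallyFinite_regularize (S : PointSet) : S.regularize.LocallyFinite := by
  unfold regularize
  split_ifs with h
  · exact h
  · simp [LocallyFinite, PointSet.count]

theorem LocallyFinite.regularize_eq {S : PointSet} (h : S.LocallyFinite) : S.regularize = S :=
  if_pos h

theorem measurable_regularize : Measurable regularize :=
  Measurable.ite measurableSet_locallyFinite measurable_id measurable_const

end PointSet

/-- There is a chain of `k` shortcuts from `v` to `t` of length less than `c`. The points are taken
in `[0, ∞)` rather than in `[0, l]`, so that the domain does not depend on `l`. -/
def ChainLT (h g : ContPath) (l : ℝ≥0) (Q : Set (ℝ≥0 × ℝ≥0)) (t : ℝ≥0) : ℕ → ℝ≥0 → ℝ → Prop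
  | 0, v, c => treeDist h v t < c
  | k + 1, v, c => ∃ q ∈ Q, (q.2 : ℝ) < g q.1 ∧ q.1 ≤ l ∧ shortcutEnd g q.1 q.2 ≤ l ∧
      (ChainLT h g l Q t k (shortcutEnd g q.1 q.2) (c - treeDist h v q.1) ∨
        ChainLT h g l Q t k q.1 (c - treeDist h v (shortcutEnd g q.1 q.2)))

theorem chainLT_iff (h g : ContPath) (l : ℝ≥0) (Q : Set (ℝ≥0 × ℝ≥0)) (t : Set.Icc (0 : ℝ≥0) l)
    (k : ℕ) (v : Set.Icc (0 : ℝ≥0) l) (c : ℝ) :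
    ChainLT h g l Q t k v c ↔ ∃ L : List (Set.Icc (0 : ℝ≥0) l × Set.Icc (0 : ℝ≥0) l),
      L.length = k ∧ (∀ p ∈ L, Shortcut g l Q p.1 p.2 ∨ Shortcut g l Q p.2 p.1) ∧
      chainCost (fun s t : Set.Icc (0 : ℝ≥0) l => treeDist h s t) L v t < c := by
  induction k generalizing v c with
  | zero =>
    constructor
    · intro hc
      exact ⟨[], rfl, by simp, hc⟩
    · rintro ⟨L, hL, _, hc⟩
      rw [List.length_eq_zero_iff.1 hL] at hc
      exact hc
  | succ k ih =>
    constructor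
    · rintro ⟨q, hqQ, hqg, hql, hrl, hc⟩
      have key (u w : Set.Icc (0 : ℝ≥0) l) (hs : Shortcut g l Q u w ∨ Shortcut g l Q w u)
          (hc : ChainLT h g l Q t k w (c - treeDist h v u)) :
          ∃ L : List (Set.Icc (0 : ℝ≥0) l × Set.Icc (0 : ℝ≥0) l),
          L.length = k + 1 ∧ (∀ p ∈ L, Shortcut g l Q p.1 p.2 ∨ Shortcut g l Q p.2 p.1) ∧
          chainCost (fun s t : Set.Icc (0 : ℝ≥0) l => treeDist h s t) L v t < c := by
        obtain ⟨L, hLk, hL, hLc⟩ := (ih _ _).1 hc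
        refine ⟨(u, w) :: L, by simp [hLk], ?_, ?_⟩
        · intro p hp
          rcases List.mem_cons.1 hp with rfl | hp
          · exact hs
          · exact hL p hp
        · simp only [chainCost]; linarith
      have hs : Shortcut g l Q ⟨q.1, zero_le, hql⟩ ⟨shortcutEnd g q.1 q.2, zero_le, hrl⟩ :=
        ⟨q, hqQ, hqg, rfl, rfl⟩
      rcases hc with hc | hc
      · exact key _ _ (Or.inl hs) hc
      · exact key _ _ (Or.inr hs) hc
    · rintro ⟨L, hLk, hL, hc⟩
      match L, hLk with
      | p :: L, hLk =>
        have hc' : ChainLT h g l Q t k p.2 (c - treeDist h v p.1) := by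
          refine (ih _ _).2 ⟨L, by simpa using hLk, fun p hp => hL p (List.mem_cons_of_mem _ hp), ?_⟩
          simp only [chainCost] at hc
          linarith
        rcases hL p List.mem_cons_self with ⟨q, hqQ, hqg, h1, h2⟩ | ⟨q, hqQ, hqg, h1, h2⟩
        · refine ⟨q, hqQ, hqg, h1 ▸ p.1.2.2, h2 ▸ p.2.2.2, Or.inl ?_⟩
          rw [← h2, ← h1]; exact hc'
        · refine ⟨q, hqQ, hqg, h1 ▸ p.2.2.2, h2 ▸ p.1.2.2, Or.inr ?_⟩
          rw [← h2, ← h1]; exact hc'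

theorem gluedDist_lt_iff (h g : ContPath) (l : ℝ≥0) (Q : Set (ℝ≥0 × ℝ≥0))
    (s t : Set.Icc (0 : ℝ≥0) l) (c : ℝ) :
    gluedDist h g l Q s t < c ↔ ∃ k, ChainLT h g l Q t k s c := by
  rw [gluedDist, quotDist, ciInf_lt_iff (bddBelow_chainCost _ _ (fun _ _ => treeDist_nonneg _ _ _)
    s t)]
  simp only [chainLT_iff]
  constructor
  · rintro ⟨L, hL⟩
    exact ⟨_, L.1, rfl, L.2, hL⟩
  · rintro ⟨k, L, _, hL, hc⟩
    exact ⟨⟨L, hL⟩, hc⟩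

section

variable {α : Type*} [MeasurableSpace α] {h g : α → ContPath} {l t : α → ℝ≥0} {Q : α → PointSet}

theorem measurableSet_chainLT (hh : Measurable h) (hg : Measurable g) (hl : Measurable l)
    (ht : Measurable t) (hQ : Measurable Q) (hlf : ∀ a, (Q a).LocallyFinite) (k : ℕ) :
    MeasurableSet {x : α × ℝ≥0 × ℝ |
      ChainLT (h x.1) (g x.1) (l x.1) (Q x.1).points (t x.1) k x.2.1 x.2.2} := by
  induction k with
  | zero =>
    exact measurableSet_lt (measurable_treeDist (hh.comp measurable_fst) (by fun_prop)
      (ht.comp measurable_fst)) (by fun_prop)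
  | succ k ih =>
    have hend : Measurable fun y : (α × ℝ≥0 × ℝ) × (ℝ≥0 × ℝ≥0) =>
        shortcutEnd (g y.1.1) y.2.1 y.2.2 :=
      measurable_shortcutEnd (hg.comp (by fun_prop)) (by fun_prop) (by fun_prop)
    have h1 : MeasurableSet {y : (α × ℝ≥0 × ℝ) × (ℝ≥0 × ℝ≥0) | (y.2.2 : ℝ) < g y.1.1 y.2.1} :=
      measurableSet_lt (by fun_prop)
        (ContPath.measurable_apply (hg.comp (by fun_prop)) (by fun_prop))
    have h2 : MeasurableSet {y : (α × ℝ≥0 × ℝ) × (ℝ≥0 × ℝ≥0) | y.2.1 ≤ l y.1.1} :=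
      measurableSet_le (by fun_prop) (hl.comp (by fun_prop))
    have h3 : MeasurableSet {y : (α × ℝ≥0 × ℝ) × (ℝ≥0 × ℝ≥0) |
        shortcutEnd (g y.1.1) y.2.1 y.2.2 ≤ l y.1.1} :=
      measurableSet_le hend (hl.comp (by fun_prop))
    have m1 : Measurable fun y : (α × ℝ≥0 × ℝ) × (ℝ≥0 × ℝ≥0) =>
        (y.1.1, shortcutEnd (g y.1.1) y.2.1 y.2.2, y.1.2.2 - treeDist (h y.1.1) y.1.2.1 y.2.1) := by
      refine Measurable.prodMk (by fun_prop) (hend.prodMk (Measurable.sub (by fun_prop) ?_))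
      exact measurable_treeDist (hh.comp (by fun_prop)) (by fun_prop) (by fun_prop)
    have m2 : Measurable fun y : (α × ℝ≥0 × ℝ) × (ℝ≥0 × ℝ≥0) =>
        (y.1.1, y.2.1, y.1.2.2 -
          treeDist (h y.1.1) y.1.2.1 (shortcutEnd (g y.1.1) y.2.1 y.2.2)) := by
      refine Measurable.prodMk (by fun_prop) (Measurable.prodMk (by fun_prop)
        (Measurable.sub (by fun_prop) ?_))
      exact measurable_treeDist (hh.comp (by fun_prop)) (by fun_prop) hend
    exact PointSet.measurableSet_exists_mem (hQ.comp measurable_fst) (fun a => hlf a.1)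
      (h1.inter (h2.inter (h3.inter ((m1 ih).union (m2 ih)))))

theorem measurable_gluedDist (hh : Measurable h) (hg : Measurable g) (hl : Measurable l)
    (hQ : Measurable Q) (hlf : ∀ a, (Q a).LocallyFinite) {s t : ∀ a, Set.Icc (0 : ℝ≥0) (l a)}
    (hs : Measurable fun a => (s a : ℝ≥0)) (ht : Measurable fun a => (t a : ℝ≥0)) :
    Measurable fun a => gluedDist (h a) (g a) (l a) (Q a).points (s a) (t a) := by
  refine measurable_of_Iio fun c => ?_
  have : (fun a => gluedDist (h a) (g a) (l a) (Q a).points (s a) (t a)) ⁻¹' Set.Iio c =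
      ⋃ k, {a | ChainLT (h a) (g a) (l a) (Q a).points (t a) k (s a) c} := by
    ext a
    simp only [Set.mem_preimage, Set.mem_Iio, gluedDist_lt_iff, Set.mem_iUnion, Set.mem_ofPred_eq]
  rw [this]
  refine MeasurableSet.iUnion fun k => ?_
  exact (measurable_id.prodMk (hs.prodMk measurable_const))
    (measurableSet_chainLT hh hg hl ht hQ hlf k)

end

/-! ### Parametrization of trees with shortcuts -/

/-- The homothety from `[0, 1]` onto `[0, l]`. -/
def stretch (l : ℝ≥0) (s : unitInterval) : Set.Icc (0 : ℝ≥0) l :=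
  ⟨l * unitInterval.toNNReal s, zero_le, mul_le_of_le_one_right zero_le s.2.2⟩

theorem continuous_stretch (l : ℝ≥0) : Continuous (stretch l) := by
  unfold stretch
  refine Continuous.subtype_mk (continuous_const.mul ?_) _
  exact continuous_subtype_val.subtype_mk _

theorem surjective_stretch (l : ℝ≥0) : Function.Surjective (stretch l) := by
  rintro ⟨x, hx0, hxl⟩
  rcases eq_or_ne l 0 with rfl | hl
  · refine ⟨0, Subtype.ext ?_⟩
    have : x = 0 := le_antisymm hxl hx0
    simp [stretch, this]
  · refine ⟨⟨x / l, by positivity, ?_⟩, Subtype.ext (NNReal.eq ?_)⟩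
    · have hl' : (0 : ℝ) < l := NNReal.coe_pos.2 (pos_of_ne_zero hl)
      exact (div_le_one hl').2 hxl
    · have hl' : (l : ℝ) ≠ 0 := NNReal.coe_ne_zero.2 hl
      change (l : ℝ) * (x / l) = x
      field_simp

theorem lebesgueNN_comap_eq (l : ℝ≥0) :
    lebesgueNN.comap (Subtype.val : Set.Icc (0 : ℝ≥0) l → ℝ≥0) =
      l • (volume : Measure unitInterval).map (stretch l) := by
  have e1 : MeasurableEmbedding (Subtype.val : Set.Icc (0 : ℝ≥0) l → ℝ≥0) :=
    MeasurableEmbedding.subtype_coe measurableSet_Icc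
  have e2 : MeasurableEmbedding NNReal.toReal := NNReal.isClosedEmbedding_coe.measurableEmbedding
  have e3 := e2.comp e1
  have inj : Function.Injective (Measure.map (NNReal.toReal ∘ (Subtype.val : Set.Icc 0 l → ℝ≥0))) :=
    fun μ ν h => by rw [← e3.comap_map μ, ← e3.comap_map ν, h]
  apply inj
  have hr : Set.range (NNReal.toReal ∘ (Subtype.val : Set.Icc 0 l → ℝ≥0)) = Set.Icc (0 : ℝ) l := by
    ext x
    constructor
    · rintro ⟨y, rfl⟩
      exact ⟨y.1.2, y.2.2⟩
    · rintro ⟨h0, hl⟩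
      exact ⟨⟨⟨x, h0⟩, zero_le, hl⟩, rfl⟩
  have hc : lebesgueNN.comap (Subtype.val : Set.Icc (0 : ℝ≥0) l → ℝ≥0) =
      (volume : Measure ℝ).comap (NNReal.toReal ∘ (Subtype.val : Set.Icc 0 l → ℝ≥0)) := by
    ext A hA
    rw [e1.comap_apply, lebesgueNN, e2.comap_apply, e3.comap_apply, Set.image_comp]
  rw [hc, e3.map_comap, hr, Measure.map_smul,
    Measure.map_map e3.measurable (continuous_stretch l).measurable]
  have hcomp : (NNReal.toReal ∘ (Subtype.val : Set.Icc 0 l → ℝ≥0)) ∘ stretch l =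
      (fun x : ℝ => l * x) ∘ (Subtype.val : unitInterval → ℝ) := rfl
  rw [hcomp, ← Measure.map_map (by fun_prop) measurable_subtype_coe,
    unitInterval.measurePreserving_coe.map_eq]
  rcases eq_or_ne l 0 with rfl | hl
  · simp
  · have hl' : (0 : ℝ) < l := NNReal.coe_pos.2 (pos_of_ne_zero hl)
    have himg : unitInterval = (fun x : ℝ => l * x) ⁻¹' Set.Icc (0 : ℝ) l := by
      ext x
      simp only [Set.mem_Icc, Set.mem_preimage]
      constructor
      · rintro ⟨h0, h1⟩
        exact ⟨by positivity, mul_le_of_le_one_right hl'.le h1⟩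
      · rintro ⟨h0, h1⟩
        exact ⟨nonneg_of_mul_nonneg_right h0 hl', by nlinarith⟩
    rw [himg, ← Measure.restrict_map (by fun_prop) measurableSet_Icc,
      Real.map_volume_mul_left hl'.ne', Measure.restrict_smul, abs_of_pos (inv_pos.2 hl'),
      ENNReal.ofReal_inv_of_pos hl', ENNReal.ofReal_coe_nnreal, ENNReal.smul_def, smul_smul,
      ENNReal.mul_inv_cancel (by simpa using hl) ENNReal.coe_ne_top, one_smul]

/-- The tree with shortcuts is parametrized by the homothety onto `[0, l]`, with mass `l`. -/
theorem isParam_shortcutSpace (h g : ContPath) (l : ℝ≥0) (Q : Set (ℝ≥0 × ℝ≥0)) :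
    MMSpace.IsParam (shortcutSpace h g l Q) l (fun s => gluedProj h g l Q (stretch l s)) where
  continuous := (continuous_gluedProj h g l Q).comp (continuous_stretch l)
  surjective := (surjective_gluedProj h g l Q).comp (surjective_stretch l)
  measure := by
    let _ : MeasurableSpace (SeparationQuotient (GluedInterval h g l Q)) := borel _
    have _ : BorelSpace (SeparationQuotient (GluedInterval h g l Q)) := ⟨rfl⟩
    change (lebesgueNN.comap (Subtype.val : Set.Icc (0 : ℝ≥0) l → ℝ≥0)).map (gluedProj h g l Q) = _
    rw [lebesgueNN_comap_eq, Measure.map_smul, Measure.map_map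
      (continuous_gluedProj h g l Q).measurable (continuous_stretch l).measurable]
    rfl

theorem MMSpace.IsParam.scl {X : MMSpace} {m : ℝ≥0} {p : unitInterval → X.carrier}
    (hp : X.IsParam m p) (α β : ℝ) (hα : 0 < α) :
    (MMSpace.scl α β hα X).IsParam (β.toNNReal * m) p where
  continuous := hp.continuous
  surjective := hp.surjective
  measure := by
    change β.toNNReal • X.μ = _
    rw [hp.measure, smul_smul]
    rfl

/-! ### Scaling of trees with shortcuts -/

/-- The rescaled path `u ↦ k h(a u)`. -/
def scalePath (k : ℝ) (a : ℝ≥0) (h : ContPath) : ContPath :=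
  ⟨fun u => k * h (a * u), by fun_prop⟩

theorem scalePath_apply (k : ℝ) (a : ℝ≥0) (h : ContPath) (u : ℝ≥0) :
    scalePath k a h u = k * h (a * u) := rfl

theorem scalePath_smul (k c : ℝ) (a : ℝ≥0) (h : ContPath) :
    scalePath k a (c • h) = (k * c) • scalePath 1 a h := by
  ext u
  simp [scalePath_apply, mul_assoc]

theorem measurable_scalePath (k : ℝ) (a : ℝ≥0) : Measurable (scalePath k a) :=
  ContPath.measurable_iff.2 fun u => ((ContPath.measurable_iff.1 measurable_id) (a * u)).const_mul k

/-- The set of the points `(x / a, k y)` for the points `(x, y)` of `S`. -/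
def PointSet.scale (a k : ℝ≥0) (S : PointSet) : PointSet :=
  ⟨(fun p : ℝ≥0 × ℝ≥0 => (p.1 / a, k * p.2)) '' S.points⟩

section

variable {a : ℝ≥0} (ha : a ≠ 0)
include ha

theorem image_scalePath_uIcc (k : ℝ) (h : ContPath) (u v : ℝ≥0) :
    scalePath k a h '' Set.uIcc u v = (fun x => k * x) '' (h '' Set.uIcc (a * u) (a * v)) := by
  have : Set.uIcc (a * u) (a * v) = (fun x => a * x) '' Set.uIcc u v := by
    have hm : Monotone fun x : ℝ≥0 => a * x := fun x y hxy => mul_le_mul_right hxy a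
    ext x
    constructor
    · intro hx
      refine ⟨x / a, ?_, mul_div_cancel₀ x ha⟩
      rw [Set.uIcc, Set.mem_Icc] at hx ⊢
      rw [← hm.map_min, ← hm.map_max] at hx
      have hp := pos_of_ne_zero ha
      exact ⟨(le_div_iff₀' hp).2 hx.1, (div_le_iff₀' hp).2 hx.2⟩
    · rintro ⟨y, hy, rfl⟩
      rw [Set.uIcc, Set.mem_Icc, ← hm.map_min, ← hm.map_max]
      exact ⟨hm hy.1, hm hy.2⟩
  rw [this, Set.image_image, Set.image_image]
  rfl

theorem sInf_scalePath_uIcc {k : ℝ} (hk : 0 ≤ k) (h : ContPath) (u v : ℝ≥0) :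
    sInf (scalePath k a h '' Set.uIcc u v) = k * sInf (h '' Set.uIcc (a * u) (a * v)) := by
  rw [image_scalePath_uIcc ha, ← smul_eq_mul k, ← Real.sInf_smul_of_nonneg hk]
  rfl

theorem treeDist_scalePath {k : ℝ} (hk : 0 ≤ k) (h : ContPath) (u v : ℝ≥0) :
    treeDist (scalePath k a h) u v = k * treeDist h (a * u) (a * v) := by
  rw [treeDist, treeDist, sInf_scalePath_uIcc ha hk, scalePath_apply, scalePath_apply]
  ring

theorem shortcutEnd_scalePath {k : ℝ≥0} (hk : k ≠ 0) (g : ContPath) (x y : ℝ≥0) :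
    shortcutEnd (scalePath k a g) (x / a) (k * y) = shortcutEnd g x y / a := by
  have hp := pos_of_ne_zero ha
  have hk' : (0 : ℝ) < k := NNReal.coe_pos.2 (pos_of_ne_zero hk)
  refine eq_of_forall_ge_iff fun c => ?_
  rw [div_le_iff₀' hp, shortcutEnd_le_iff, shortcutEnd_le_iff, sInf_scalePath_uIcc ha k.coe_nonneg,
    mul_div_cancel₀ x ha, div_le_iff₀' hp, NNReal.coe_mul]
  refine or_congr (and_congr_right fun _ => mul_le_mul_iff_right₀ hk') ?_
  -- Both alternatives say that `g` stays above `y` after `x`.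
  have key (b : ℝ≥0) (hb : b ≠ 0) : (∀ n : ℕ, ¬ sInf (g '' Set.uIcc x (x + b * n)) ≤ y) ↔
      ∀ x', x ≤ x' → ¬ g x' ≤ y := by
    constructor
    · intro h x' hx' hg
      obtain ⟨n, hn⟩ := exists_nat_ge (x' / b)
      refine h n ((exists_le_iff_sInf_image_le g le_self_add y).1 ⟨x', hx', ?_, hg⟩)
      exact ((div_le_iff₀' (pos_of_ne_zero hb)).1 hn).trans le_add_self
    · intro h n hn
      obtain ⟨x', h1, _, h3⟩ := (exists_le_iff_sInf_image_le g le_self_add y).2 hn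
      exact h x' h1 h3
  have h1 := key 1 one_ne_zero
  simp only [one_mul] at h1
  rw [h1, ← key a ha]
  refine forall_congr' fun n => not_congr ?_
  rw [sInf_scalePath_uIcc ha k.coe_nonneg, mul_add, mul_div_cancel₀ x ha]
  exact mul_le_mul_iff_right₀ hk'

theorem chainLT_scalePath {k : ℝ} (hk : 0 < k) {k' : ℝ≥0} (hk' : k' ≠ 0) (h g : ContPath)
    (l : ℝ≥0) (Q : PointSet) (t : ℝ≥0) (n : ℕ) (v : ℝ≥0) (c : ℝ) :
    ChainLT (scalePath k a h) (scalePath k' a g) (l / a) (Q.scale a k').points (t / a) n (v / a)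
      (k * c) ↔ ChainLT h g l Q.points t n v c := by
  have hp := pos_of_ne_zero ha
  have hk'' : (0 : ℝ) < k' := NNReal.coe_pos.2 (pos_of_ne_zero hk')
  induction n generalizing v c with
  | zero =>
    rw [ChainLT, ChainLT, treeDist_scalePath ha hk.le, mul_div_cancel₀ _ ha, mul_div_cancel₀ _ ha]
    exact mul_lt_mul_iff_right₀ hk
  | succ n ih =>
    simp only [ChainLT, PointSet.scale, Set.exists_mem_image]
    refine exists_congr fun q => and_congr_right fun hq => ?_
    rw [shortcutEnd_scalePath ha hk', treeDist_scalePath ha hk.le, treeDist_scalePath ha hk.le,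
      ← mul_sub, ← mul_sub, scalePath_apply, mul_div_cancel₀ _ ha, mul_div_cancel₀ _ ha,
      mul_div_cancel₀ _ ha, NNReal.coe_mul, mul_lt_mul_iff_right₀ hk'',
      div_le_div_iff_of_pos_right hp, div_le_div_iff_of_pos_right hp]
    exact and_congr_right fun _ => and_congr_right fun _ => and_congr_right fun _ =>
      or_congr (ih _ _) (ih _ _)

theorem gluedDist_scalePath {k : ℝ} (hk : 0 < k) {k' : ℝ≥0} (hk' : k' ≠ 0) (h g : ContPath)
    (l : ℝ≥0) (Q : PointSet) (s t : unitInterval) :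
    gluedDist (scalePath k a h) (scalePath k' a g) (l / a) (Q.scale a k').points
      (stretch (l / a) s) (stretch (l / a) t) =
      k * gluedDist h g l Q.points (stretch l s) (stretch l t) := by
  have hst (s : unitInterval) : (stretch (l / a) s : ℝ≥0) = stretch l s / a :=
    div_mul_eq_mul_div _ _ _
  refine eq_of_forall_gt_iff fun c => ?_
  obtain ⟨c, rfl⟩ : ∃ c', c = k * c' := ⟨c / k, (mul_div_cancel₀ _ hk.ne').symm⟩
  rw [mul_lt_mul_iff_right₀ hk, gluedDist_lt_iff, gluedDist_lt_iff, hst, hst]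
  exact exists_congr fun n => chainLT_scalePath ha hk hk' h g l Q _ n _ c

/-- Rescaling the ingredients amounts to rescaling the space. -/
theorem shortcutSpace_mem_iff_scl {α : ℝ} (hα : 0 < α) (h g : ContPath) (l : ℝ≥0) (Q : PointSet)
    {S : Set MMSpace} (hS : MeasurableSet S) :
    shortcutSpace h g l Q.points ∈ S ↔
      MMSpace.scl α a hα (shortcutSpace (scalePath α⁻¹ a h) (scalePath a a g) (l / a)
        (Q.scale a a).points) ∈ S := by
  have hp := (isParam_shortcutSpace (scalePath α⁻¹ a h) (scalePath a a g) (l / a)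
        (Q.scale a a).points).scl α a hα
  rw [Real.toNNReal_coe, mul_div_cancel₀ _ ha] at hp
  refine MMSpace.mem_iff_of_isParam (isParam_shortcutSpace h g l Q.points) hp (fun s t => ?_) hS
  change gluedDist _ _ _ _ _ _ = α * gluedDist _ _ _ _ _ _
  rw [gluedDist_scalePath ha (inv_pos.2 hα) ha, mul_inv_cancel_left₀ hα.ne']

end

/-- Over an interval of length `0` all trees with shortcuts are the same. -/
theorem shortcutSpace_zero_mem_iff_scl {α β : ℝ} (hα : 0 < α) (h g h' g' : ContPath)
    (Q Q' : Set (ℝ≥0 × ℝ≥0)) {S : Set MMSpace} (hS : MeasurableSet S) :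
    MMSpace.scl α β hα (shortcutSpace h g 0 Q) ∈ S ↔
      MMSpace.scl α β hα (shortcutSpace h' g' 0 Q') ∈ S := by
  refine MMSpace.mem_iff_of_isParam ((isParam_shortcutSpace h g 0 Q).scl α β hα)
    ((isParam_shortcutSpace h' g' 0 Q').scl α β hα) (fun s t => ?_) hS
  have hst : stretch 0 s = stretch 0 t := Subtype.ext (by simp [stretch])
  change α * gluedDist _ _ _ _ _ _ = α * gluedDist _ _ _ _ _ _
  rw [hst, gluedDist_self, gluedDist_self]

section

variable {α : Type*} [MeasurableSpace α] {h g : α → ContPath} {l : α → ℝ≥0} {Q : α → PointSet}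

/-- The rescaled tree with shortcuts depends measurably on its ingredients. -/
theorem measurable_scl_shortcutSpace {b β : ℝ} (hb : 0 < b) (hh : Measurable h)
    (hg : Measurable g) (hl : Measurable l) (hQ : Measurable Q) (hlf : ∀ a, (Q a).LocallyFinite) :
    Measurable fun a => MMSpace.scl b β hb (shortcutSpace (h a) (g a) (l a) (Q a).points) := by
  refine MMSpace.measurable_of_isParam (fun a => (isParam_shortcutSpace _ _ _ _).scl b β hb)
    (hl.const_mul _) fun s t => ?_
  change Measurable fun a => b * gluedDist (h a) (g a) (l a) (Q a).points _ _
  exact (measurable_gluedDist hh hg hl hQ hlf (hl.mul_const _) (hl.mul_const _)).const_mul b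

end

/-! ### Ranked excursion lengths -/

theorem natCast_le_encard_iff {X : Type*} {E : Set X} {n : ℕ} :
    (n : ℕ∞) ≤ E.encard ↔ ∃ e : Fin n → X, Function.Injective e ∧ ∀ a, e a ∈ E := by
  constructor
  · intro h
    obtain ⟨t, htE, ht⟩ := Set.exists_subset_encard_eq h
    have hfin : t.Finite := Set.encard_ne_top_iff.1 (by simp [ht])
    lift t to Finset X using hfin
    rw [Set.encard_coe_eq_coe_finsetCard] at ht
    have hc : t.card = n := by exact_mod_cast ht
    exact ⟨fun a => (t.equivFinOfCardEq hc).symm a,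
      Subtype.val_injective.comp (Equiv.injective _), fun a => htE (Subtype.coe_prop _)⟩
  · rintro ⟨e, he, hE⟩
    have h1 : (Set.range e).encard = n := by
      rw [← Set.image_univ, he.encard_image, Set.encard_univ]
      simp
    rw [← h1]
    exact Set.encard_le_encard (Set.range_subset_iff.2 hE)

/-- There are more than `i` excursions of length more than `c`. -/
def ManyExcursions (f : ℝ≥0 → ℝ) (i : ℕ) (c : ℝ≥0) : Prop :=
  ((i + 1 : ℕ) : ℕ∞) ≤ {p ∈ excursionIntervals f | c < p.2 - p.1}.encard

theorem exists_rankedLength_set_iff (f : ℝ≥0 → ℝ) (i : ℕ) (c : ℝ≥0) :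
    (∃ x ∈ {x | 0 < x ∧ ((i + 1 : ℕ) : ℕ∞) ≤ {p ∈ excursionIntervals f | x ≤ p.2 - p.1}.encard},
      c < x) ↔ ManyExcursions f i c := by
  constructor
  · rintro ⟨x, ⟨_, hx⟩, hcx⟩
    exact hx.trans (Set.encard_le_encard fun p hp => ⟨hp.1, hcx.trans_le hp.2⟩)
  · intro h
    obtain ⟨e, he, hE⟩ := natCast_le_encard_iff.1 h
    obtain ⟨a, _, ha⟩ := Finset.exists_min_image Finset.univ (fun a => (e a).2 - (e a).1)
      Finset.univ_nonempty
    refine ⟨(e a).2 - (e a).1, ⟨pos_of_gt (hE a).2, natCast_le_encard_iff.2 ⟨e, he, fun b =>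
      ⟨(hE b).1, ha b (Finset.mem_univ _)⟩⟩⟩, (hE a).2⟩

/-- The last condition says that the set of lengths in the definition of `rankedLength` is bounded;
otherwise its supremum is `0`. -/
theorem lt_rankedLength_iff (f : ℝ≥0 → ℝ) (i : ℕ) (c : ℝ≥0) :
    c < rankedLength f i ↔ ManyExcursions f i c ∧ ∃ N : ℕ, ¬ ManyExcursions f i N := by
  rw [rankedLength]
  simp only [← exists_rankedLength_set_iff]
  set T := {x | 0 < x ∧ ((i + 1 : ℕ) : ℕ∞) ≤ {p ∈ excursionIntervals f | x ≤ p.2 - p.1}.encard}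
    with hT
  have hb : (∃ N : ℕ, ¬ ∃ x ∈ T, (N : ℝ≥0) < x) ↔ BddAbove T := by
    constructor
    · rintro ⟨N, hN⟩
      push Not at hN
      exact ⟨N, hN⟩
    · rintro ⟨M, hM⟩
      obtain ⟨N, hN⟩ := exists_nat_ge M
      refine ⟨N, ?_⟩
      push Not
      exact fun x hx => (hM hx).trans hN
  rw [hb]
  constructor
  · intro h
    have hbdd : BddAbove T := by
      by_contra hbdd
      rw [NNReal.sSup_of_not_bddAbove hbdd] at h
      exact not_lt_zero h
    have hne : T.Nonempty := by
      by_contra hne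
      rw [Set.not_nonempty_iff_eq_empty.1 hne, csSup_empty] at h
      exact not_lt_zero h
    exact ⟨exists_lt_of_lt_csSup hne h, hbdd⟩
  · rintro ⟨⟨x, hx, hcx⟩, hbdd⟩
    exact hcx.trans_le (le_csSup hbdd hx)

section Scaling

variable {a : ℝ≥0} (ha : a ≠ 0) {k : ℝ} (hk : 0 < k)
include ha

theorem forall_Ioo_div_iff {P : ℝ≥0 → Prop} {u v : ℝ≥0} :
    (∀ t ∈ Set.Ioo u v, P (a * t)) ↔ ∀ t ∈ Set.Ioo (a * u) (a * v), P t := by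
  have hp := pos_of_ne_zero ha
  constructor
  · intro h t ht
    have := h (t / a) ⟨(lt_div_iff₀' hp).2 ht.1, (div_lt_iff₀' hp).2 ht.2⟩
    rwa [mul_div_cancel₀ _ ha] at this
  · exact fun h t ht => h _ ⟨(mul_lt_mul_iff_right₀ hp).2 ht.1, (mul_lt_mul_iff_right₀ hp).2 ht.2⟩

include hk

theorem manyExcursions_scale (f : ℝ≥0 → ℝ) (i : ℕ) (c : ℝ≥0) :
    ManyExcursions (fun u => k * f (a * u)) i c ↔ ManyExcursions f i (a * c) := by
  have hp := pos_of_ne_zero ha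
  have hbij : Function.Bijective fun p : ℝ≥0 × ℝ≥0 => (a * p.1, a * p.2) :=
    Function.Bijective.prodMap (mulLeft_bijective₀ a ha) (mulLeft_bijective₀ a ha)
  rw [ManyExcursions, ManyExcursions,
    ← Set.encard_preimage_of_bijective hbij {p ∈ excursionIntervals f | a * c < p.2 - p.1}]
  have : {p ∈ excursionIntervals (fun u => k * f (a * u)) | c < p.2 - p.1} =
      (fun p : ℝ≥0 × ℝ≥0 => (a * p.1, a * p.2)) ⁻¹'
        {p ∈ excursionIntervals f | a * c < p.2 - p.1} := by
    ext p
    simp only [excursionIntervals, Set.mem_preimage, Set.mem_ofPred_eq, mul_eq_zero, hk.ne',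
      false_or, mul_pos_iff_of_pos_left hk, ← mul_tsub, mul_lt_mul_iff_right₀ hp]
    rw [forall_Ioo_div_iff ha (P := fun t => 0 < f t)]
  rw [this]

theorem rankedLength_scale (f : ℝ≥0 → ℝ) (i : ℕ) :
    rankedLength (fun u => k * f (a * u)) i = rankedLength f i / a := by
  have hp := pos_of_ne_zero ha
  refine eq_of_forall_lt_iff fun c => ?_
  rw [lt_div_iff₀' hp, lt_rankedLength_iff, lt_rankedLength_iff, manyExcursions_scale ha hk]
  refine and_congr_right fun _ => ?_
  simp only [manyExcursions_scale ha hk]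
  have mono {c c' : ℝ≥0} (h : c ≤ c') : ManyExcursions f i c' → ManyExcursions f i c := fun h' =>
    h'.trans (Set.encard_le_encard fun p hp => ⟨hp.1, h.trans_lt hp.2⟩)
  constructor
  · rintro ⟨N, hN⟩
    obtain ⟨M, hM⟩ := exists_nat_ge (a * N)
    exact ⟨M, fun h => hN (mono hM h)⟩
  · rintro ⟨N, hN⟩
    obtain ⟨M, hM⟩ := exists_nat_ge (N / a)
    exact ⟨M, fun h => hN (mono ((div_le_iff₀' hp).1 hM) h)⟩

theorem reflectedPath_scale (w : ℝ≥0 → ℝ) :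
    reflectedPath (fun u => k * w (a * u)) = fun u => k * reflectedPath w (a * u) := by
  have hp := pos_of_ne_zero ha
  ext u
  have : (fun u => k * w (a * u)) '' Set.Icc 0 u = (fun x => k • x) '' (w '' Set.Icc 0 (a * u)) := by
    rw [Set.image_image]
    ext x
    constructor
    · rintro ⟨v, hv, rfl⟩
      exact ⟨a * v, ⟨zero_le, mul_le_mul_right hv.2 a⟩, rfl⟩
    · rintro ⟨v, hv, rfl⟩
      refine ⟨v / a, ⟨zero_le, (div_le_iff₀' hp).2 hv.2⟩, ?_⟩
      simp [mul_div_cancel₀ _ ha]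
  rw [reflectedPath, reflectedPath, this]
  have h := Real.sInf_smul_of_nonneg hk.le (w '' Set.Icc 0 (a * u))
  rw [← Set.image_smul] at h
  rw [h, smul_eq_mul, ← mul_sub]

omit hk in
/-- The Brownian scaling of the path with parabolic drift. -/
theorem parabolicPath_scale {κ σ lam lam' b : ℝ} (hb : 0 < b) (h1 : b = κ * √a)
    (h2 : b = σ * a ^ 2) (h3 : lam * a = b * lam') (w : ℝ≥0 → ℝ) :
    parabolicPath 1 1 lam' (fun u => (√a)⁻¹ * w (a * u)) =
      fun u => b⁻¹ * parabolicPath κ σ lam w (a * u) := by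
  have hp : (0 : ℝ) < √a := Real.sqrt_pos.2 (NNReal.coe_pos.2 (pos_of_ne_zero ha))
  ext u
  rw [eq_inv_mul_iff_mul_eq₀ hb.ne']
  simp only [parabolicPath, NNReal.coe_mul]
  have e1 : b * (√a)⁻¹ = κ := by rw [h1]; field_simp
  linear_combination (w (a * u)) * e1 - (u : ℝ) * h3 - ((u : ℝ) ^ 2 / 2) * h2

end Scaling

/-! ### Measurability of the ranked excursion lengths -/

/-- The pair `(d i, d j)` is contained in an excursion of the non-negative path `f`, and
`d j - d i > c`. -/
def IsExcursionWitness (f : ContPath) (d : ℕ → ℝ≥0) (c : ℝ≥0) (w : ℕ × ℕ) : Prop :=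
  d w.1 < d w.2 ∧ c < d w.2 - d w.1 ∧ (¬ ∃ z ∈ Set.uIcc (d w.1) (d w.2), f z = 0) ∧
    (∃ z ∈ Set.uIcc 0 (d w.1), f z = 0) ∧ ∃ N : ℕ, ∃ z ∈ Set.uIcc (d w.2) (d w.2 + N), f z = 0

/-- The excursion is bounded by the last zero before `d i` and the first zero after `d j`. -/
theorem IsExcursionWitness.exists_excursion {f : ContPath} (hf : ∀ t, 0 ≤ f t) {d : ℕ → ℝ≥0}
    {c : ℝ≥0} {w : ℕ × ℕ} (h : IsExcursionWitness f d c w) :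
    ∃ p ∈ excursionIntervals f, c < p.2 - p.1 ∧ p.1 ≤ d w.1 ∧
      ∀ z ≤ d w.1, f z = 0 → z ≤ p.1 := by
  obtain ⟨h1, h2, h3, ⟨z₀, hz₀, hz₀'⟩, N, z₁, hz₁, hz₁'⟩ := h
  rw [Set.uIcc_of_le zero_le] at hz₀
  rw [Set.uIcc_of_le le_self_add] at hz₁
  rw [Set.uIcc_of_le h1.le] at h3
  push Not at h3
  have hc0 : IsClosed {z | f z = 0} := isClosed_eq f.continuous continuous_const
  have bdd : BddAbove {z | z ≤ d w.1 ∧ f z = 0} := ⟨d w.1, fun z hz => hz.1⟩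
  have m1 : sSup {z | z ≤ d w.1 ∧ f z = 0} ∈ {z | z ≤ d w.1 ∧ f z = 0} :=
    ((isClosed_le continuous_id continuous_const).inter hc0).csSup_mem ⟨z₀, hz₀.2, hz₀'⟩ bdd
  have m2 : sInf {z | d w.2 ≤ z ∧ f z = 0} ∈ {z | d w.2 ≤ z ∧ f z = 0} :=
    ((isClosed_le continuous_const continuous_id).inter hc0).csInf_mem ⟨z₁, hz₁.1, hz₁'⟩
      (OrderBot.bddBelow _)
  refine ⟨(sSup {z | z ≤ d w.1 ∧ f z = 0}, sInf {z | d w.2 ≤ z ∧ f z = 0}),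
    ⟨m1.1.trans_lt (h1.trans_le m2.1), m1.2, m2.2, fun t ht => lt_of_le_of_ne (hf t) fun h0 => ?_⟩,
    h2.trans_le (tsub_le_tsub m2.1 m1.1), m1.1, fun z hz hz0 => le_csSup bdd ⟨hz, hz0⟩⟩
  rcases le_total t (d w.1) with ht1 | ht1
  · exact ht.1.not_ge (le_csSup bdd ⟨ht1, h0.symm⟩)
  · rcases le_total (d w.2) t with ht2 | ht2
    · exact ht.2.not_ge (csInf_le (OrderBot.bddBelow _) ⟨ht2, h0.symm⟩)
    · exact h3 t ⟨ht1, ht2⟩ h0.symm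

theorem excursion_disjoint {f : ℝ≥0 → ℝ} {p q : ℝ≥0 × ℝ≥0} (hp : p ∈ excursionIntervals f)
    (hq : q ∈ excursionIntervals f) (hpq : p ≠ q) : p.2 ≤ q.1 ∨ q.2 ≤ p.1 := by
  have key : ∀ {p q : ℝ≥0 × ℝ≥0}, p ∈ excursionIntervals f → q ∈ excursionIntervals f →
      p.1 ≤ q.1 → q.1 < p.2 → p = q := by
    intro p q hp hq h1 h2
    have h3 : p.1 = q.1 := by
      by_contra hne
      exact (hp.2.2.2 q.1 ⟨lt_of_le_of_ne h1 hne, h2⟩).ne' hq.2.1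
    refine Prod.ext h3 (le_antisymm (le_of_not_gt fun h => ?_) (le_of_not_gt fun h => ?_))
    · exact (hp.2.2.2 q.2 ⟨h3 ▸ hq.1, h⟩).ne' hq.2.2.1
    · exact (hq.2.2.2 p.2 ⟨h3 ▸ hp.1, h⟩).ne' hp.2.2.1
  by_contra! h
  rcases le_total p.1 q.1 with h1 | h1
  · exact hpq (key hp hq h1 h.1)
  · exact hpq (key hq hp h1 h.2).symm

/-- Distinct excursions are told apart by zeros between pairs of points of a dense sequence. -/
theorem manyExcursions_iff {f : ContPath} (hf : ∀ t, 0 ≤ f t) {d : ℕ → ℝ≥0} (hd : DenseRange d)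
    (i : ℕ) (c : ℝ≥0) :
    ManyExcursions f i c ↔ ∃ φ : Fin (i + 1) → ℕ × ℕ, (∀ a, IsExcursionWitness f d c (φ a)) ∧
      ∀ a b, a ≠ b → ∃ z ∈ Set.uIcc (d (φ a).1) (d (φ b).1), f z = 0 := by
  rw [ManyExcursions, natCast_le_encard_iff]
  constructor
  · rintro ⟨e, he, hE⟩
    have hw (a : Fin (i + 1)) : ∃ w : ℕ × ℕ, IsExcursionWitness f d c w ∧
        (e a).1 < d w.1 ∧ d w.1 < (e a).2 := by
      obtain ⟨⟨h1, h2, h3, h4⟩, h5⟩ := hE a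
      obtain ⟨_, ⟨j, rfl⟩, hj⟩ := Dense.exists_between hd (lt_tsub_iff_left.1 h5)
      obtain ⟨_, ⟨k, rfl⟩, hk⟩ := Dense.exists_between hd (lt_tsub_iff_right.2 hj.1)
      have hkj : d k < d j := hk.2.trans_le tsub_le_self
      refine ⟨(k, j), ⟨hkj, lt_tsub_comm.1 hk.2, ?_, ⟨(e a).1, ?_, h2⟩, ?_⟩, hk.1, hkj.trans hj.2⟩
      · rintro ⟨z, hz, hz0⟩
        rw [Set.uIcc_of_le hkj.le] at hz
        exact (h4 z ⟨hk.1.trans_le hz.1, hz.2.trans_lt hj.2⟩).ne' hz0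
      · rw [Set.uIcc_of_le zero_le]
        exact ⟨zero_le, hk.1.le⟩
      · obtain ⟨N, hN⟩ := exists_nat_ge (e a).2
        refine ⟨N, (e a).2, ?_, h3⟩
        rw [Set.uIcc_of_le le_self_add]
        exact ⟨hj.2.le, hN.trans le_add_self⟩
    choose φ hφ hφ1 hφ2 using hw
    refine ⟨φ, hφ, fun a b hab => ?_⟩
    rcases excursion_disjoint (hE a).1 (hE b).1 (he.ne hab) with h | h
    · exact ⟨(e a).2, Set.mem_uIcc.2 (Or.inl ⟨(hφ2 a).le, h.trans (hφ1 b).le⟩), (hE a).1.2.2.1⟩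
    · exact ⟨(e b).2, Set.mem_uIcc.2 (Or.inr ⟨(hφ2 b).le, h.trans (hφ1 a).le⟩), (hE b).1.2.2.1⟩
  · rintro ⟨φ, hφ, hsep⟩
    choose e he hlen hle hmax using fun a => (hφ a).exists_excursion hf
    refine ⟨e, ?_, fun a => ⟨he a, hlen a⟩⟩
    have key : ∀ a b, d (φ a).1 ≤ d (φ b).1 → a ≠ b → e a ≠ e b := by
      intro a b hle' hab heq
      obtain ⟨z, hz, hz0⟩ := hsep a b hab
      rw [Set.uIcc_of_le hle'] at hz
      have h1 : z ≤ d (φ a).1 := (hmax b z hz.2 hz0).trans (heq ▸ hle a)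
      have h2 : d (φ a).1 = z := le_antisymm hz.1 h1
      exact (hφ a).2.2.1 ⟨z, by rw [← h2]; exact Set.left_mem_uIcc, hz0⟩
    intro a b heq
    by_contra hab
    rcases le_total (d (φ a).1) (d (φ b).1) with h | h
    · exact key a b h hab heq
    · exact key b a h (Ne.symm hab) heq.symm

theorem exists_zero_iff {f : ContPath} (hf : ∀ t, 0 ≤ f t) (s t : ℝ≥0) :
    (∃ z ∈ Set.uIcc s t, f z = 0) ↔ sInf (f '' Set.uIcc s t) ≤ 0 := by
  constructor
  · rintro ⟨z, hz, h0⟩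
    exact h0 ▸ sInf_uIcc_le f hz
  · intro h
    obtain ⟨z, hz, h1⟩ := (isCompact_uIcc.image f.continuous).sInf_mem
      (Set.nonempty_uIcc (a := s) (b := t).image f)
    exact ⟨z, hz, le_antisymm (h1 ▸ h) (hf z)⟩

theorem measurable_rankedLength {α : Type*} [MeasurableSpace α] {f : α → ContPath}
    (hf : Measurable f) (h0 : ∀ a t, 0 ≤ f a t) (i : ℕ) :
    Measurable fun a => rankedLength (f a) i := by
  have hz (s t : ℝ≥0) : Measurable fun a => ∃ z ∈ Set.uIcc s t, f a z = 0 := by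
    simp only [exists_zero_iff (h0 _)]
    exact measurableSet_setOfPred.1 (measurableSet_le
      (measurable_sInf_image_uIcc hf measurable_const measurable_const) measurable_const)
  have hm (c : ℝ≥0) : Measurable fun a => ManyExcursions (f a) i c := by
    simp only [manyExcursions_iff (h0 _) (TopologicalSpace.denseRange_denseSeq ℝ≥0)]
    refine Measurable.exists fun φ => Measurable.and (Measurable.forall fun b => ?_)
      (Measurable.forall fun b => Measurable.forall fun b' => ?_)
    · exact measurable_const.and (measurable_const.and ((hz _ _).not.and
        ((hz _ _).and (Measurable.exists fun N => hz _ _))))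
    · exact measurable_const.imp (hz _ _)
  refine measurable_of_Ioi fun c => ?_
  have : (fun a => rankedLength (f a) i) ⁻¹' Set.Ioi c = {a | ManyExcursions (f a) i c ∧
      ∃ N : ℕ, ¬ ManyExcursions (f a) i N} := by
    ext a
    exact lt_rankedLength_iff _ _ _
  rw [this]
  exact measurableSet_setOfPred.2 ((hm c).and (Measurable.exists fun N => (hm _).not))

theorem image_Icc_zero_eq (w : ℝ≥0 → ℝ) (s : ℝ≥0) :
    w '' Set.Icc 0 s = (fun u => w (s * u)) '' Set.Icc 0 1 := by
  ext y
  constructor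
  · rintro ⟨x, hx, rfl⟩
    rcases eq_or_ne s 0 with rfl | hs
    · exact ⟨0, ⟨le_rfl, zero_le⟩, by simp [le_antisymm hx.2 hx.1]⟩
    · exact ⟨x / s, ⟨zero_le, div_le_one_of_le₀ hx.2 zero_le⟩, by
        simp only [mul_div_cancel₀ x hs]⟩
  · rintro ⟨x, hx, rfl⟩
    exact ⟨s * x, ⟨zero_le, mul_le_of_le_one_right zero_le hx.2⟩, rfl⟩

theorem continuous_parabolicPath (κ σ lam : ℝ) (w : ContPath) :
    Continuous (parabolicPath κ σ lam w) := by
  unfold parabolicPath; fun_prop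

/-- The reflected path with parabolic drift, as a continuous path. -/
def reflectedParabola (κ σ lam : ℝ) (w : ContPath) : ContPath where
  toFun := reflectedPath (parabolicPath κ σ lam w)
  continuous_toFun := by
    have hc := continuous_parabolicPath κ σ lam w
    refine hc.sub ?_
    rw [funext fun s => congrArg sInf (image_Icc_zero_eq (parabolicPath κ σ lam w) s)]
    exact isCompact_Icc.continuous_sInf (hc.comp (continuous_fst.mul continuous_snd))

theorem reflectedParabola_nonneg (κ σ lam : ℝ) (w : ContPath) (t : ℝ≥0) :
    0 ≤ reflectedParabola κ σ lam w t :=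
  sub_nonneg.2 (csInf_le (isCompact_Icc.image (continuous_parabolicPath κ σ lam w)).bddBelow
    ⟨t, ⟨zero_le, le_rfl⟩, rfl⟩)

theorem measurable_reflectedParabola (κ σ lam : ℝ) : Measurable (reflectedParabola κ σ lam) := by
  have h1 : Measurable fun w : ContPath =>
      (⟨parabolicPath κ σ lam w, continuous_parabolicPath κ σ lam w⟩ : ContPath) :=
    ContPath.measurable_iff.2 fun t => ((((ContPath.measurable_iff.1 measurable_id) t).const_mul
      κ).add_const _).sub_const _
  refine ContPath.measurable_iff.2 fun t => ((ContPath.measurable_iff.1 h1) t).sub ?_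
  rw [← Set.uIcc_of_le (zero_le : 0 ≤ t)]
  exact measurable_sInf_image_uIcc h1 measurable_const measurable_const

theorem measurable_rankedLength_reflectedParabola (κ σ lam : ℝ) (i : ℕ) :
    Measurable fun w : ContPath => rankedLength (reflectedPath (parabolicPath κ σ lam w)) i :=
  measurable_rankedLength (measurable_reflectedParabola κ σ lam)
    (reflectedParabola_nonneg κ σ lam) i

/-! ### Continuous versions of processes -/

section ContinuousVersion

variable {Ω : Type*} [MeasurableSpace Ω] {P : Measure Ω} {B : ℝ≥0 → Ω → ℝ}

/-- A process with almost surely continuous paths is almost surely equal to a random element of the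
space of continuous paths. -/
theorem exists_measurable_contPath (hB : ∀ t, AEMeasurable (B t) P)
    (hc : ∀ᵐ ω ∂P, Continuous (B · ω)) :
    ∃ β : Ω → ContPath, Measurable β ∧ ∀ᵐ ω ∂P, ∀ t, β ω t = B t ω := by
  classical
  set d := TopologicalSpace.denseSeq ℝ≥0
  have hgood : ∀ᵐ ω ∂P, Continuous (B · ω) ∧ ∀ k, B (d k) ω = (hB (d k)).mk _ ω :=
    hc.and (ae_all_iff.2 fun k => (hB (d k)).ae_eq_mk)
  obtain ⟨N, hN, hNm, hN0⟩ := exists_measurable_superset_of_null (ae_iff.1 hgood)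
  have hgN : ∀ ω ∉ N, Continuous (B · ω) ∧ ∀ k, B (d k) ω = (hB (d k)).mk _ ω := fun ω hω => by
    by_contra h
    exact hω (hN h)
  let β : Ω → ContPath := fun ω => if h : ω ∉ N then ⟨(B · ω), (hgN ω h).1⟩ else 0
  refine ⟨β, ContPath.measurable_iff.2 fun t => ?_, ?_⟩
  · have hk (k : ℕ) : Measurable fun ω => β ω (d k) := by
      have : (fun ω => β ω (d k)) = Nᶜ.indicator ((hB (d k)).mk _) := by
        ext ω
        by_cases h : ω ∉ N
        · rw [Set.indicator_of_mem (by exact h)]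
          simp only [β, dif_pos h]
          exact (hgN ω h).2 k
        · rw [Set.indicator_of_notMem (by exact h)]
          simp only [β, dif_neg h]
          rfl
      rw [this]
      exact (hB (d k)).measurable_mk.indicator hNm.compl
    obtain ⟨x, hx, hxt⟩ := mem_closure_iff_seq_limit.1
      ((TopologicalSpace.denseRange_denseSeq ℝ≥0) t)
    refine measurable_of_tendsto_metrizable (f := fun n ω => β ω (x n)) (fun n => ?_) ?_
    · obtain ⟨k, hk'⟩ := hx n
      exact hk' ▸ hk k
    · exact tendsto_pi_nhds.2 fun ω => ((β ω).continuous.tendsto t).comp hxt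
  · filter_upwards [measure_eq_zero_iff_ae_notMem.1 hN0] with ω hω t
    simp only [β, dif_pos hω]
    rfl

/-- The `σ`-algebra on paths is induced by the inclusion into all functions. -/
theorem ContPath.map_coe_injective {μ ν : Measure ContPath}
    (h : μ.map (fun h : ContPath => (h : ℝ≥0 → ℝ)) = ν.map fun h : ContPath => (h : ℝ≥0 → ℝ)) :
    μ = ν := by
  ext A hA
  obtain ⟨A', hA', rfl⟩ := hA
  rw [← Measure.map_apply ContPath.measurable_coe hA', h,
    Measure.map_apply ContPath.measurable_coe hA']

/-- Continuity is what makes an uncountable family of random variables a random function. -/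
theorem aemeasurable_pi_of_continuous (hB : ∀ t, AEMeasurable (B t) P)
    (hc : ∀ᵐ ω ∂P, Continuous (B · ω)) : AEMeasurable (fun ω t => B t ω) P := by
  obtain ⟨β, hβ, h⟩ := exists_measurable_contPath hB hc
  refine ⟨fun ω => (β ω : ℝ≥0 → ℝ), ContPath.measurable_coe.comp hβ, ?_⟩
  filter_upwards [h] with ω hω
  ext t
  exact (hω t).symm

theorem ProbabilityTheory.IsBrownianReal.isProbabilityMeasure (hB : IsBrownianReal B P) :
    IsProbabilityMeasure P :=
  (hB.hasLaw_eval 0).isProbabilityMeasure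

theorem ProbabilityTheory.IsBrownianReal.aemeasurable_pi (hB : IsBrownianReal B P) :
    AEMeasurable (fun ω t => B t ω) P :=
  aemeasurable_pi_of_continuous hB.aemeasurable hB.cont

theorem ProbabilityTheory.IsBrownianReal.isProjectiveLimit (hB : IsBrownianReal B P) :
    IsProjectiveLimit (P.map fun ω t => B t ω) BrownianReal.projectiveFamily := fun I => by
  rw [← (hB.hasLaw I).map_eq, AEMeasurable.map_map_of_aemeasurable
    (by fun_prop) hB.aemeasurable_pi]
  rfl

/-- Brownian motions have the same law on the space of all paths. -/
theorem ProbabilityTheory.IsBrownianReal.map_eq {Ω' : Type*} [MeasurableSpace Ω'] {P' : Measure Ω'}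
    {B' : ℝ≥0 → Ω' → ℝ} (hB : IsBrownianReal B P) (hB' : IsBrownianReal B' P') :
    P.map (fun ω t => B t ω) = P'.map fun ω t => B' t ω :=
  IsProjectiveLimit.unique hB.isProjectiveLimit hB'.isProjectiveLimit

theorem ProbabilityTheory.IsBrownianReal.exists_contPath (hB : IsBrownianReal B P) :
    ∃ β : Ω → ContPath, Measurable β ∧ ∀ᵐ ω ∂P, ∀ t, β ω t = B t ω :=
  exists_measurable_contPath hB.aemeasurable hB.cont

/-- Random continuous paths have the same law if they have the same law as random functions. -/
theorem map_contPath_eq {Ω' : Type*} [MeasurableSpace Ω'] {P' : Measure Ω'}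
    {B' : ℝ≥0 → Ω' → ℝ} (h : P.map (fun ω t => B t ω) = P'.map fun ω t => B' t ω)
    {β : Ω → ContPath} (hβ : AEMeasurable β P) (hβB : ∀ᵐ ω ∂P, ∀ t, β ω t = B t ω)
    {β' : Ω' → ContPath} (hβ' : AEMeasurable β' P') (hβB' : ∀ᵐ ω ∂P', ∀ t, β' ω t = B' t ω) :
    P.map β = P'.map β' := by
  refine ContPath.map_coe_injective ?_
  rw [AEMeasurable.map_map_of_aemeasurable ContPath.measurable_coe.aemeasurable hβ,
    AEMeasurable.map_map_of_aemeasurable ContPath.measurable_coe.aemeasurable hβ']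
  refine (Measure.map_congr ?_).trans (h.trans (Measure.map_congr ?_))
  · filter_upwards [hβB] with ω hω using funext hω
  · filter_upwards [hβB'] with ω hω using funext fun t => (hω t).symm

end ContinuousVersion

/-! ### Lebesgue measure on the half-line -/

instance : IsFiniteMeasureOnCompacts lebesgueNN :=
  IsFiniteMeasureOnCompacts.comap' volume NNReal.continuous_coe
    NNReal.isClosedEmbedding_coe.measurableEmbedding

theorem lebesgueNN_map_mul {a : ℝ≥0} (ha : a ≠ 0) :
    lebesgueNN.map (fun x => a * x) = a⁻¹ • lebesgueNN := by
  have e : MeasurableEmbedding NNReal.toReal := NNReal.isClosedEmbedding_coe.measurableEmbedding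
  have inj : Function.Injective (Measure.map NNReal.toReal) :=
    fun μ ν h => by rw [← e.comap_map μ, ← e.comap_map ν, h]
  have ha' : (0 : ℝ) < a := NNReal.coe_pos.2 (pos_of_ne_zero ha)
  apply inj
  have hr : Set.range NNReal.toReal = (fun x : ℝ => a * x) ⁻¹' Set.range NNReal.toReal := by
    ext x
    simp only [NNReal.range_coe, Set.mem_Ici, Set.mem_preimage, mul_nonneg_iff_of_pos_left ha']
  have hcomp : NNReal.toReal ∘ (fun x => a * x) = (fun x : ℝ => a * x) ∘ NNReal.toReal := by
    ext x; simp
  rw [Measure.map_map e.measurable (by fun_prop), hcomp, ← Measure.map_map (by fun_prop)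
    e.measurable, Measure.map_smul, lebesgueNN, e.map_comap, hr, ← Measure.restrict_map
    (by fun_prop) e.measurableSet_range, Real.map_volume_mul_left ha'.ne', Measure.restrict_smul,
    ← hr, abs_of_pos (inv_pos.2 ha'), ← NNReal.coe_inv, ENNReal.ofReal_coe_nnreal,
    ENNReal.smul_def]

/-! ### Brownian excursions -/

/-- The Euclidean norm at time `t` of the bridge of duration `l` made of the path `w`, continued
by `0` after time `l`. -/
def bridgeNorm (l : ℝ≥0) (w : Fin 3 → ℝ≥0 → ℝ) (t : ℝ≥0) : ℝ :=
  if t ≤ l then √(∑ j, (w j t - (t / l : ℝ) * w j l) ^ 2) else 0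

theorem measurable_bridgeNorm (l : ℝ≥0) : Measurable (bridgeNorm l) := by
  refine measurable_pi_iff.2 fun t => ?_
  unfold bridgeNorm
  split_ifs
  · fun_prop
  · exact measurable_const

theorem IsExcursionLaw.unique {l : ℝ≥0} {ν ν' : Measure ContPath} (h : IsExcursionLaw l ν)
    (h' : IsExcursionLaw l ν') : ν = ν' := by
  obtain ⟨Ω, _, P, B, e, hB, hi, he, hν⟩ := h
  obtain ⟨Ω', _, P', B', e', hB', hi', he', hν'⟩ := h'
  have hP : IsProbabilityMeasure P := (hB 0).isProbabilityMeasure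
  have hP' : IsProbabilityMeasure P' := (hB' 0).isProbabilityMeasure
  rw [← hν.map_eq, ← hν'.map_eq]
  have hm := fun j => (hB j).aemeasurable_pi
  have hm' := fun j => (hB' j).aemeasurable_pi
  refine map_contPath_eq (B := fun t ω => bridgeNorm l (fun j t => B j t ω) t)
    (B' := fun t ω => bridgeNorm l (fun j t => B' j t ω) t) ?_ hν.aemeasurable he
    hν'.aemeasurable he'
  have key := (iIndepFun_iff_map_fun_eq_pi_map hm).1 hi
  have key' := (iIndepFun_iff_map_fun_eq_pi_map hm').1 hi'
  rw [funext fun j => (hB j).map_eq (hB' j), ← key'] at key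
  have := congrArg (Measure.map (bridgeNorm l)) key
  rwa [AEMeasurable.map_map_of_aemeasurable (measurable_bridgeNorm l).aemeasurable
    (aemeasurable_pi_lambda _ hm), AEMeasurable.map_map_of_aemeasurable
    (measurable_bridgeNorm l).aemeasurable (aemeasurable_pi_lambda _ hm')] at this

/-- Brownian scaling of the Brownian excursion. -/
theorem IsExcursionLaw.scale {l : ℝ≥0} {ν : Measure ContPath} (h : IsExcursionLaw l ν) {a : ℝ≥0}
    (ha : a ≠ 0) : IsExcursionLaw (l / a) (ν.map (scalePath (√a)⁻¹ a)) := by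
  obtain ⟨Ω, _, P, B, e, hB, hi, he, hν⟩ := h
  have hm := measurable_scalePath (√a)⁻¹ a
  refine ⟨Ω, _, P, fun j t ω => (√a)⁻¹ * B j (a * t) ω, fun ω => scalePath (√a)⁻¹ a (e ω),
    fun j => (hB j).smul ha, ?_, ?_, ?_⟩
  · exact hi.comp (fun _ w t => (√a)⁻¹ * w (a * t)) fun _ => by fun_prop
  · filter_upwards [he] with ω hω t
    have hp := pos_of_ne_zero ha
    have hr : (a : ℝ) ≠ 0 := NNReal.coe_ne_zero.2 ha
    rw [scalePath_apply, hω, if_congr (le_div_iff₀' hp) rfl rfl, mul_div_cancel₀ _ ha]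
    split_ifs
    · have : ∀ j, ((√a)⁻¹ * B j (a * t) ω - (t / (l / a : ℝ≥0) : ℝ) * ((√a)⁻¹ * B j l ω)) ^ 2 =
          ((√a)⁻¹) ^ 2 * (B j (a * t) ω - ((a * t : ℝ≥0) / l : ℝ) * B j l ω) ^ 2 := by
        intro j
        have : (t / (l / a : ℝ≥0) : ℝ) = (a * t : ℝ≥0) / l := by
          rw [NNReal.coe_div, NNReal.coe_mul, div_div_eq_mul_div, mul_comm (t : ℝ)]
        rw [this]; ring
      rw [Finset.sum_congr rfl fun j _ => this j, ← Finset.mul_sum,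
        Real.sqrt_mul (sq_nonneg _), Real.sqrt_sq (by positivity)]
    · simp
  · exact HasLaw.comp ⟨hm.aemeasurable, rfl⟩ hν

/-! ### Tilted Brownian excursions -/

/-- The area under a path up to time `l`. -/
def area (l : ℝ≥0) (h : ContPath) : ℝ := ∫ s in Set.Icc 0 l, h s ∂lebesgueNN

theorem measurable_area (l : ℝ≥0) : Measurable (area l) :=
  (StronglyMeasurable.integral_prod_right (ν := lebesgueNN.restrict (Set.Icc 0 l))
    (f := fun (h : ContPath) s => h s)
    ContPath.measurable_uncurry.stronglyMeasurable).measurable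

theorem area_scalePath {a : ℝ≥0} (ha : a ≠ 0) (k : ℝ) (l : ℝ≥0) (h : ContPath) :
    area (l / a) (scalePath k a h) = k / a * area l h := by
  have e : MeasurableEmbedding fun x : ℝ≥0 => a * x :=
    (Homeomorph.mulLeft₀ a ha).measurableEmbedding
  have hs : Set.Icc 0 (l / a) = (fun x : ℝ≥0 => a * x) ⁻¹' Set.Icc 0 l := by
    ext x
    simp [le_div_iff₀' (pos_of_ne_zero ha)]
  have h1 := e.setIntegral_map (μ := lebesgueNN) h (Set.Icc 0 l)
  rw [lebesgueNN_map_mul ha, Measure.restrict_smul, ← hs] at h1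
  rw [area]
  simp only [scalePath_apply]
  rw [integral_const_mul, ← h1, integral_smul_nnreal_measure, area, NNReal.smul_def,
    NNReal.coe_inv, smul_eq_mul, div_eq_mul_inv, mul_assoc]

theorem map_tilted {α β : Type*} [MeasurableSpace α] [MeasurableSpace β] (μ : Measure α)
    {S : α → β} (hS : Measurable S) {f : β → ℝ} (hf : Measurable f) :
    (μ.tilted (fun x => f (S x))).map S = (μ.map S).tilted f := by
  ext A hA
  rw [Measure.map_apply hS hA, tilted_apply' _ _ (hS hA), tilted_apply' _ _ hA,
    setLIntegral_map hA (by fun_prop) hS, integral_map hS.aemeasurable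
      (by fun_prop : Measurable fun y => Real.exp (f y)).aestronglyMeasurable]

theorem IsTiltedExcursionLaw.unique {θ : ℝ} {l : ℝ≥0} {ν ν' : Measure ContPath}
    (h : IsTiltedExcursionLaw θ l ν) (h' : IsTiltedExcursionLaw θ l ν') : ν = ν' := by
  obtain ⟨ν₀, h0, rfl⟩ := h
  obtain ⟨ν₀', h0', rfl⟩ := h'
  rw [h0.unique h0']

/-- Brownian scaling of the tilted excursion. -/
theorem IsTiltedExcursionLaw.scale {θ θ' : ℝ} {l : ℝ≥0} {ν : Measure ContPath}
    (h : IsTiltedExcursionLaw θ l ν) {a : ℝ≥0} (ha : a ≠ 0) (hθ : θ' = θ * (a * √a)) :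
    IsTiltedExcursionLaw θ' (l / a) (ν.map (scalePath (√a)⁻¹ a)) := by
  obtain ⟨ν₀, h0, rfl⟩ := h
  refine ⟨_, h0.scale ha, ?_⟩
  change _ = (ν₀.map (scalePath (√a)⁻¹ a)).tilted fun h => θ' * area (l / a) h
  rw [← map_tilted _ (measurable_scalePath _ _) ((measurable_area _).const_mul _)]
  congr 2
  ext h
  have hp : (0 : ℝ) < √a := Real.sqrt_pos.2 (NNReal.coe_pos.2 (pos_of_ne_zero ha))
  have hr : (a : ℝ) ≠ 0 := NNReal.coe_ne_zero.2 ha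
  rw [area_scalePath ha, hθ]
  change θ * area l h = _
  field_simp

theorem measurable_scalePath_uncurry :
    Measurable fun x : ℝ≥0 × ContPath => scalePath (√(x.1⁻¹ : ℝ≥0))⁻¹ x.1⁻¹ x.2 := by
  refine ContPath.measurable_iff.2 fun t => Measurable.mul (by fun_prop) ?_
  exact ContPath.measurable_apply measurable_snd (by fun_prop)

/-- The law of the tilted excursion depends measurably on the length, since it is obtained by
scaling from the Brownian excursion of length `1` with a tilt that depends on the length. -/
theorem measurable_isTiltedExcursionLaw {θ : ℝ} {ν : ℝ≥0 → Measure ContPath}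
    (hν : ∀ l, 0 < l → IsTiltedExcursionLaw θ l (ν l)) {C : Set ContPath} (hC : MeasurableSet C) :
    Measurable fun l => ν l C := by
  obtain ⟨ν₀, h0, -⟩ := hν 1 one_pos
  have hprob : IsProbabilityMeasure ν₀ := by
    obtain ⟨Ω, _, P, B, e, hB, hi, he, hν⟩ := h0
    have hP : IsProbabilityMeasure P := (hB 0).isProbabilityMeasure
    rw [← hν.map_eq]
    exact Measure.isProbabilityMeasure_map hν.aemeasurable
  let f (l : ℝ≥0) (h : ContPath) : ℝ := θ * (l * √l) * area 1 h
  have hf : Measurable (Function.uncurry f) :=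
    Measurable.mul (by fun_prop) ((measurable_area 1).comp measurable_snd)
  have key (l : ℝ≥0) (hl : l ≠ 0) : ν l C = ∫⁻ h,
      {x : ℝ≥0 × ContPath | scalePath (√(x.1⁻¹ : ℝ≥0))⁻¹ x.1⁻¹ x.2 ∈ C}.indicator
        (fun x => ENNReal.ofReal (Real.exp (f x.1 x.2) / ∫ h', Real.exp (f x.1 h') ∂ν₀)) (l, h)
        ∂ν₀ := by
    have h1 : IsTiltedExcursionLaw (θ * (l * √l)) 1 (ν₀.tilted (f l)) := ⟨ν₀, h0, rfl⟩
    have hp : (0 : ℝ) < √l := Real.sqrt_pos.2 (NNReal.coe_pos.2 (pos_of_ne_zero hl))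
    have hr : (l : ℝ) ≠ 0 := NNReal.coe_ne_zero.2 hl
    have h2 := h1.scale (θ' := θ) (inv_ne_zero hl) (by
      rw [NNReal.coe_inv, Real.sqrt_inv]; field_simp)
    rw [one_div, inv_inv] at h2
    have hm : Measurable (scalePath (√(l⁻¹ : ℝ≥0))⁻¹ l⁻¹) := measurable_scalePath _ _
    rw [(hν l (pos_of_ne_zero hl)).unique h2, Measure.map_apply hm hC, tilted_apply' _ _ (hm hC),
      ← lintegral_indicator (hm hC)]
    rfl
  have hF : Measurable fun l => ∫⁻ h,
      {x : ℝ≥0 × ContPath | scalePath (√(x.1⁻¹ : ℝ≥0))⁻¹ x.1⁻¹ x.2 ∈ C}.indicator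
        (fun x => ENNReal.ofReal (Real.exp (f x.1 x.2) / ∫ h', Real.exp (f x.1 h') ∂ν₀)) (l, h)
        ∂ν₀ := by
    refine Measurable.lintegral_prod_right (Measurable.indicator ?_
      (measurable_scalePath_uncurry hC))
    refine ENNReal.measurable_ofReal.comp ((Real.measurable_exp.comp hf).div ?_)
    exact (StronglyMeasurable.integral_prod_right (ν := ν₀) (f := fun l h' => Real.exp (f l h'))
      (Real.measurable_exp.comp hf).stronglyMeasurable).measurable.comp measurable_fst
  have : (fun l => ν l C) = fun l => if l = 0 then ν 0 C else ∫⁻ h,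
      {x : ℝ≥0 × ContPath | scalePath (√(x.1⁻¹ : ℝ≥0))⁻¹ x.1⁻¹ x.2 ∈ C}.indicator
        (fun x => ENNReal.ofReal (Real.exp (f x.1 x.2) / ∫ h', Real.exp (f x.1 h') ∂ν₀)) (l, h)
        ∂ν₀ := by
    ext l
    split_ifs with hl
    · rw [hl]
    · exact key l hl
  rw [this]
  exact Measurable.ite (measurableSet_singleton 0) measurable_const hF

/-! ### Poisson point processes -/

instance : BorelSpace ℕ∞ := ⟨by
  rw [borel_eq_top_of_countable]
  exact top_le_iff.1 fun s _ => MeasurableSet.of_discrete⟩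

namespace PointSet

theorem measurable_of_count {α : Type*} [MeasurableSpace α] {f : α → PointSet}
    (h : ∀ A, MeasurableSet A → Measurable fun a => count A (f a)) : Measurable f := by
  rw [measurable_iff_comap_le]
  change MeasurableSpace.comap f (⨆ A : {A : Set (ℝ≥0 × ℝ≥0) // MeasurableSet A},
    MeasurableSpace.comap (PointSet.count A.1) ⊤) ≤ _
  rw [MeasurableSpace.comap_iSup]
  refine iSup_le fun A => ?_
  rw [MeasurableSpace.comap_comp]
  exact measurable_iff_comap_le.1 ((h A.1 A.2).mono le_rfl fun s _ => MeasurableSet.of_discrete)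

/-- All numbers of points in measurable sets. -/
def counts (S : PointSet) (A : {A : Set (ℝ≥0 × ℝ≥0) // MeasurableSet A}) : ℕ∞ := count A.1 S

theorem measurable_counts : Measurable counts :=
  measurable_pi_iff.2 fun A => measurable_count A.2

/-- The `σ`-algebra on sets of points is induced by the numbers of points. -/
theorem map_counts_injective {μ ν : Measure PointSet} (h : μ.map counts = ν.map counts) :
    μ = ν := by
  have hm : ∀ A : Set PointSet, MeasurableSet A → MeasurableSet[MeasurableSpace.comap counts
      MeasurableSpace.pi] A := by
    refine (?_ : (⨆ A : {A : Set (ℝ≥0 × ℝ≥0) // MeasurableSet A},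
      MeasurableSpace.comap (PointSet.count A.1) ⊤) ≤ _)
    rw [MeasurableSpace.pi, MeasurableSpace.comap_iSup]
    refine iSup_mono fun A => ?_
    rw [MeasurableSpace.comap_comp]
    exact MeasurableSpace.comap_mono fun s _ => MeasurableSet.of_discrete
  ext A hA
  obtain ⟨A', hA', rfl⟩ := hm A hA
  rw [← Measure.map_apply measurable_counts hA', h, Measure.map_apply measurable_counts hA']

/-- The points that belong to `A i` exactly for the `i` in `s`. -/
def atom {ι : Type*} (A : ι → Set (ℝ≥0 × ℝ≥0)) (s : Set ι) : Set (ℝ≥0 × ℝ≥0) :=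
  {x | {i | x ∈ A i} = s}

theorem measurableSet_atom {ι : Type*} [Countable ι] {A : ι → Set (ℝ≥0 × ℝ≥0)}
    (hA : ∀ i, MeasurableSet (A i)) (s : Set ι) : MeasurableSet (atom A s) := by
  have : atom A s = {x | ∀ i, x ∈ A i ↔ i ∈ s} := by
    ext x
    exact Set.ext_iff
  rw [this]
  exact measurableSet_setOfPred.2 (Measurable.forall fun i =>
    Measurable.iff (measurableSet_setOfPred.1 (hA i)) measurable_const)

theorem pairwise_disjoint_atom {ι : Type*} (A : ι → Set (ℝ≥0 × ℝ≥0)) :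
    Pairwise (Function.onFun Disjoint (atom A)) := fun _ _ hst =>
  Set.disjoint_left.2 fun _ hs ht => hst (hs.symm.trans ht)

theorem count_eq_sum_atom {ι : Type*} [Finite ι] (A : ι → Set (ℝ≥0 × ℝ≥0)) (i : ι)
    (S : PointSet) : count (A i) S = ∑ᶠ s : {s : Set ι // i ∈ s}, count (atom A s.1) S := by
  have : S.points ∩ A i = ⋃ s : {s : Set ι // i ∈ s}, S.points ∩ atom A s.1 := by
    ext x
    simp only [Set.mem_iUnion, Set.mem_inter_iff]
    constructor
    · rintro ⟨hx, hi⟩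
      exact ⟨⟨{i | x ∈ A i}, hi⟩, hx, rfl⟩
    · rintro ⟨⟨s, hs⟩, hx, hxs⟩
      refine ⟨hx, ?_⟩
      have hxs' : {i | x ∈ A i} = s := hxs
      rw [← hxs'] at hs
      exact hs
  rw [count, this, Set.encard_iUnion_of_finite]
  · rfl
  · intro s t hst
    exact ((pairwise_disjoint_atom A) (fun h => hst (Subtype.ext h))).mono
      Set.inter_subset_right Set.inter_subset_right

end PointSet

theorem lebesgueNN_prod_square_ne_top (n : ℕ) :
    (lebesgueNN.prod lebesgueNN) (PointSet.square n) ≠ ∞ := by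
  rw [PointSet.square, Measure.prod_prod]
  exact ENNReal.mul_ne_top (lebesgueNN_Icc_lt_top n).ne (lebesgueNN_Icc_lt_top n).ne

namespace IsPoissonPointProcess

open PointSet

section Unique

variable {Ω Ω' : Type*} [MeasurableSpace Ω] [MeasurableSpace Ω'] {P : Measure Ω}
  {P' : Measure Ω'} {Q : Ω → PointSet} {Q' : Ω' → PointSet}

theorem ae_locallyFinite (h : IsPoissonPointProcess P Q) : ∀ᵐ ω ∂P, (Q ω).LocallyFinite := by
  refine ae_all_iff.2 fun n => ?_
  have hl := h.poisson _ (measurableSet_square n) (lebesgueNN_prod_square_ne_top n)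
  have h0 : ∀ᵐ x ∂P.map (fun ω => (Q ω).count (square n)), x ≠ ⊤ := by
    rw [hl.map_eq, ae_map_iff Measurable.of_discrete.aemeasurable MeasurableSet.of_discrete]
    exact Filter.Eventually.of_forall fun k => ENat.natCast_ne_top k
  exact ae_of_ae_map hl.aemeasurable h0

theorem aemeasurable_count (h : IsPoissonPointProcess P Q) {A : Set (ℝ≥0 × ℝ≥0)}
    (hA : MeasurableSet A) : AEMeasurable (fun ω => (Q ω).count A) P :=
  (measurable_count hA).comp_aemeasurable h.aemeasurable

theorem _root_.PointSet.square_mono : Monotone square := by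
  rintro n m hnm x ⟨h1, h2⟩
  have : (n : ℝ≥0) ≤ m := by exact_mod_cast hnm
  exact ⟨⟨h1.1, h1.2.trans this⟩, ⟨h2.1, h2.2.trans this⟩⟩

theorem _root_.PointSet.count_le_iff_forall_square (A : Set (ℝ≥0 × ℝ≥0)) (S : PointSet) (k : ℕ∞) :
    S.count A ≤ k ↔ ∀ n, S.count (A ∩ square n) ≤ k := by
  constructor
  · exact fun hk n => (Set.encard_le_encard (Set.inter_subset_inter_right _
      Set.inter_subset_left)).trans hk
  · intro hk
    by_contra! hlt
    obtain ⟨t, ht, htk⟩ := Set.exists_subset_encard_eq (Order.add_one_le_of_lt hlt)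
    have hk' : k ≠ ⊤ := fun hk' => by simp [hk'] at hlt
    have htf : t.Finite := Set.encard_ne_top_iff.1 (by simpa [htk] using hk')
    choose N hN using exists_mem_square
    obtain ⟨M, hM⟩ := (htf.image N).bddAbove
    have hts : t ⊆ S.points ∩ (A ∩ square M) := fun x hx =>
      ⟨(ht hx).1, (ht hx).2, square_mono (hM ⟨x, hx, rfl⟩) (hN x)⟩
    have := (Set.encard_le_encard hts).trans (hk M)
    rw [htk] at this
    exact absurd ((ENat.add_one_le_iff hk').1 this) (lt_irrefl _)

/-- The square `[0, n] × [0, n]` has finite area, and the number of points in it increases to the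
number of all points. -/
theorem map_count_Iic [IsFiniteMeasure P] (h : IsPoissonPointProcess P Q)
    {A : Set (ℝ≥0 × ℝ≥0)} (hA : MeasurableSet A) (k : ℕ∞) :
    P.map (fun ω => (Q ω).count A) (Set.Iic k) =
      ⨅ n, P.map (fun ω => (Q ω).count (A ∩ square n)) (Set.Iic k) := by
  have hAn (n : ℕ) : MeasurableSet (A ∩ square n) := hA.inter (measurableSet_square n)
  simp_rw [Measure.map_apply_of_aemeasurable (h.aemeasurable_count (hAn _)) measurableSet_Iic]
  rw [Measure.map_apply_of_aemeasurable (h.aemeasurable_count hA) measurableSet_Iic,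
    ← Antitone.measure_iInter]
  · congr 1
    ext ω
    simp [count_le_iff_forall_square A]
  · exact fun n m hnm ω hω => (Set.encard_le_encard (Set.inter_subset_inter_right _
      (Set.inter_subset_inter_right _ (square_mono hnm)))).trans hω
  · exact fun n => (h.aemeasurable_count (hAn n)).nullMeasurableSet_preimage measurableSet_Iic
  · exact ⟨0, measure_ne_top _ _⟩

variable [IsProbabilityMeasure P] [IsProbabilityMeasure P']

/-- The law of the number of points in a set, possibly of infinite area, is determined. -/
theorem map_count_eq (h : IsPoissonPointProcess P Q) (h' : IsPoissonPointProcess P' Q')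
    {A : Set (ℝ≥0 × ℝ≥0)} (hA : MeasurableSet A) :
    P.map (fun ω => (Q ω).count A) = P'.map fun ω => (Q' ω).count A := by
  have hAn (n : ℕ) : MeasurableSet (A ∩ square n) := hA.inter (measurableSet_square n)
  have hfin (n : ℕ) : P.map (fun ω => (Q ω).count (A ∩ square n)) =
      P'.map fun ω => (Q' ω).count (A ∩ square n) := by
    have : (lebesgueNN.prod lebesgueNN) (A ∩ square n) ≠ ∞ :=
      ne_top_of_le_ne_top (lebesgueNN_prod_square_ne_top n) (measure_mono Set.inter_subset_right)
    rw [(h.poisson _ (hAn n) this).map_eq, (h'.poisson _ (hAn n) this).map_eq]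
  have : IsProbabilityMeasure (P.map fun ω => (Q ω).count A) :=
    Measure.isProbabilityMeasure_map (h.aemeasurable_count hA)
  refine Measure.ext_of_Iic _ _ fun k => ?_
  rw [h.map_count_Iic hA, h'.map_count_Iic hA]
  simp_rw [hfin]

theorem map_counts_disjoint_eq (h : IsPoissonPointProcess P Q) (h' : IsPoissonPointProcess P' Q')
    {n : ℕ} {A : Fin n → Set (ℝ≥0 × ℝ≥0)} (hA : ∀ i, MeasurableSet (A i))
    (hd : Pairwise (Function.onFun Disjoint A)) :
    P.map (fun ω i => (Q ω).count (A i)) = P'.map fun ω i => (Q' ω).count (A i) := by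
  rw [(iIndepFun_iff_map_fun_eq_pi_map fun i => h.aemeasurable_count (hA i)).1 (h.indep n A hA hd),
    (iIndepFun_iff_map_fun_eq_pi_map fun i => h'.aemeasurable_count (hA i)).1
      (h'.indep n A hA hd), funext fun i => h.map_count_eq h' (hA i)]

omit [IsProbabilityMeasure P] in
/-- The numbers of points in finitely many sets are sums of the numbers of points in the disjoint
atoms of these sets. -/
theorem map_counts_restrict (h : IsPoissonPointProcess P Q)
    (I : Finset {A : Set (ℝ≥0 × ℝ≥0) // MeasurableSet A}) {n : ℕ} (e : Set I ≃ Fin n) :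
    ((P.map Q).map counts).map I.restrict =
      (P.map fun ω j => (Q ω).count (atom (fun i : I => i.1.1) (e.symm j))).map
        fun c (i : I) => ∑ᶠ s : {s : Set I // i ∈ s}, c (e s.1) := by
  have hA (i : I) : MeasurableSet i.1.1 := i.1.2
  rw [Measure.map_map (by fun_prop) measurable_counts, AEMeasurable.map_map_of_aemeasurable
    (((by fun_prop : Measurable I.restrict).comp measurable_counts).aemeasurable) h.aemeasurable,
    AEMeasurable.map_map_of_aemeasurable Measurable.of_discrete.aemeasurable
    (aemeasurable_pi_lambda _ fun j => h.aemeasurable_count (measurableSet_atom hA _))]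
  congr 1
  ext ω i
  simp only [Function.comp_apply, Equiv.symm_apply_apply]
  exact count_eq_sum_atom (fun i : I => i.1.1) i (Q ω)

/-- Rate one Poisson point processes have the same law. -/
theorem map_eq (h : IsPoissonPointProcess P Q) (h' : IsPoissonPointProcess P' Q') :
    P.map Q = P'.map Q' := by
  refine map_counts_injective ?_
  have : IsProbabilityMeasure (P.map Q) := Measure.isProbabilityMeasure_map h.aemeasurable
  have : IsProbabilityMeasure ((P.map Q).map counts) :=
    Measure.isProbabilityMeasure_map measurable_counts.aemeasurable
  refine IsProjectiveLimit.unique (P := fun I => ((P.map Q).map counts).map I.restrict)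
    (fun I => rfl) fun I => ?_
  have hA (i : I) : MeasurableSet i.1.1 := i.1.2
  obtain ⟨n, ⟨e⟩⟩ := Finite.exists_equiv_fin (Set I)
  change _ = ((P.map Q).map counts).map I.restrict
  rw [h.map_counts_restrict I e, h'.map_counts_restrict I e, h.map_counts_disjoint_eq h'
    (fun j => measurableSet_atom hA _)
    fun j k hjk => pairwise_disjoint_atom _ (e.symm.injective.ne hjk)]

end Unique

section Scale

variable {Ω : Type*} [MeasurableSpace Ω] {P : Measure Ω} {Q : Ω → PointSet}

/-- The area preserving map `(x, y) ↦ (x / a, a y)`. -/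
def squeeze (a : ℝ≥0) (p : ℝ≥0 × ℝ≥0) : ℝ≥0 × ℝ≥0 := (p.1 / a, a * p.2)

theorem measurable_squeeze (a : ℝ≥0) : Measurable (squeeze a) := by
  unfold squeeze; fun_prop

variable {a : ℝ≥0} (ha : a ≠ 0)
include ha

theorem map_squeeze : (lebesgueNN.prod lebesgueNN).map (squeeze a) =
    lebesgueNN.prod lebesgueNN := by
  have h1 : squeeze a = Prod.map (fun x => a⁻¹ * x) (fun x => a * x) := by
    ext p <;> simp [squeeze, div_eq_inv_mul]
  rw [h1, ← Measure.map_prod_map _ _ (by fun_prop) (by fun_prop), lebesgueNN_map_mul ha,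
    lebesgueNN_map_mul (inv_ne_zero ha), Measure.prod_smul_left, Measure.prod_smul_right,
    smul_smul, inv_inv, mul_inv_cancel₀ ha, one_smul]

theorem count_scale (S : PointSet) (A : Set (ℝ≥0 × ℝ≥0)) :
    (S.scale a a).count A = S.count (squeeze a ⁻¹' A) := by
  have hinj : Function.Injective (squeeze a) := fun p q h => by
    have h1 := congrArg Prod.fst h
    have h2 := congrArg Prod.snd h
    exact Prod.ext ((div_left_inj' ha).1 h1) (mul_left_cancel₀ ha h2)
  have h1 : (S.scale a a).points = squeeze a '' S.points := rfl
  rw [PointSet.count, PointSet.count, h1, ← Set.image_inter_preimage, hinj.encard_image]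

theorem _root_.PointSet.measurable_scale : Measurable (PointSet.scale a a) := by
  refine measurable_of_count fun A hA => ?_
  simp only [count_scale ha]
  exact measurable_count (measurable_squeeze a hA)

theorem scale (h : IsPoissonPointProcess P Q) :
    IsPoissonPointProcess P fun ω => (Q ω).scale a a where
  aemeasurable := (PointSet.measurable_scale ha).comp_aemeasurable h.aemeasurable
  poisson A hA hfin := by
    simp only [count_scale ha]
    rw [← map_squeeze ha, Measure.map_apply (measurable_squeeze a) hA] at hfin ⊢
    exact h.poisson _ (measurable_squeeze a hA) hfin
  indep n A hA hd := by
    simp only [count_scale ha]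
    exact h.indep n _ (fun i => measurable_squeeze a (hA i)) fun i j hij =>
      (hd hij).preimage _

end Scale

end IsPoissonPointProcess

/-! ### The joint law of lengths, excursions and Poisson processes -/

section Scale

variable {Ω : Type*} [MeasurableSpace Ω] {P : Measure Ω} {κ σ lam θ : ℝ} {Z : ℕ → Ω → ℝ≥0}
  {h : ℕ → Ω → ContPath} {Q : ℕ → Ω → PointSet}

/-- Scaling turns the ingredients into those with parameters `1`. -/
theorem LimitIngredients.scale (L : LimitIngredients P κ σ lam θ Z h Q) {a : ℝ≥0} (ha : a ≠ 0)
    {lam' b : ℝ} (hb : 0 < b) (h1 : b = κ * √a) (h2 : b = σ * a ^ 2) (h3 : lam * a = b * lam')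
    (h4 : 1 = θ * (a * √a)) :
    LimitIngredients P 1 1 lam' 1 (fun i ω => Z i ω / a) (fun i ω => scalePath (√a)⁻¹ a (h i ω))
      (fun i ω => (Q i ω).scale a a) where
  lengths := by
    obtain ⟨B, hB, hZ⟩ := L.lengths
    refine ⟨_, hB.smul ha, fun i => ?_⟩
    filter_upwards [hZ i] with ω hω
    rw [parabolicPath_scale ha hb h1 h2 h3 fun s => B s ω, reflectedPath_scale ha (inv_pos.2 hb),
      rankedLength_scale ha (inv_pos.2 hb), hω]
  aemeasurable_exc i := (measurable_scalePath _ _).comp_aemeasurable (L.aemeasurable_exc i)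
  excursions := by
    obtain ⟨ν, hν, hν'⟩ := L.excursions
    refine ⟨fun l => (ν (a * l)).map (scalePath (√a)⁻¹ a), fun l hl => ?_, fun n A C hA hC => ?_⟩
    · have := (hν (a * l) (mul_pos (pos_of_ne_zero ha) hl)).scale ha h4
      rwa [mul_div_cancel_left₀ _ ha] at this
    · have hm := measurable_scalePath (√a)⁻¹ a
      have hA' : MeasurableSet ((fun (z : ℕ → ℝ≥0) i => z i / a) ⁻¹' A) :=
        (by fun_prop : Measurable fun (z : ℕ → ℝ≥0) i => z i / a) hA
      have := hν' n _ _ hA' fun i => hm (hC i)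
      refine this.trans ?_
      simp only [mul_div_cancel₀ _ ha, Measure.map_apply hm (hC _)]
      rfl
  poisson i := (L.poisson i).scale ha
  indep_poisson := L.indep_poisson.comp _ fun _ => PointSet.measurable_scale ha
  indep := L.indep.comp (φ := fun x : (ℕ → ℝ≥0) × (ℕ → ContPath) =>
      ((fun i => x.1 i / a), fun i => scalePath (√a)⁻¹ a (x.2 i)))
    (ψ := fun (q : ℕ → PointSet) i => (q i).scale a a)
    (by
      refine Measurable.prodMk (by fun_prop) (measurable_pi_iff.2 fun i => ?_)
      exact (measurable_scalePath _ _).comp (by fun_prop))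
    (measurable_pi_iff.2 fun i => (PointSet.measurable_scale ha).comp (measurable_pi_apply i))

end Scale

/-- Finite measures are determined by their values on rectangles with finitely many sides. -/
theorem measure_ext_of_rectangles {X Y : Type*} [MeasurableSpace X] [MeasurableSpace Y]
    {μ μ' : Measure (X × (ℕ → Y))} [IsFiniteMeasure μ] [IsFiniteMeasure μ']
    (h : ∀ (n : ℕ) (A : Set X) (C : ℕ → Set Y), MeasurableSet A → (∀ i, MeasurableSet (C i)) →
      μ {x | x.1 ∈ A ∧ ∀ i < n, x.2 i ∈ C i} = μ' {x | x.1 ∈ A ∧ ∀ i < n, x.2 i ∈ C i}) :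
    μ = μ' := by
  classical
  refine Measure.ext_prod fun {s t} hs ht => ?_
  have hsu : MeasurableSet (s ×ˢ (Set.univ : Set (ℕ → Y))) := hs.prod MeasurableSet.univ
  have happ (m : Measure (X × (ℕ → Y))) {S : Set (ℕ → Y)} (hS : MeasurableSet S) :
      (m.restrict (s ×ˢ Set.univ)).map Prod.snd S = m (s ×ˢ S) := by
    rw [Measure.map_apply measurable_snd hS, Measure.restrict_apply (measurable_snd hS)]
    congr 1
    ext x
    simp [and_comm]
  rw [← happ μ ht, ← happ μ' ht]
  congr 1
  refine ext_of_generate_finite _ generateFrom_squareCylinders.symm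
    (isPiSystem_squareCylinders (fun _ => MeasurableSpace.isPiSystem_measurableSet)
      fun _ => MeasurableSet.univ) ?_ ?_
  · rintro _ ⟨I, C, hC, rfl⟩
    have hC' (i : ℕ) : MeasurableSet (C i) := hC i trivial
    have hm : MeasurableSet ((I : Set ℕ).pi C) :=
      MeasurableSet.pi I.countable_toSet fun i _ => hC' i
    obtain ⟨n, hn⟩ := I.exists_nat_subset_range
    have hset : s ×ˢ ((I : Set ℕ).pi C) =
        {x : X × (ℕ → Y) | x.1 ∈ s ∧ ∀ i < n, x.2 i ∈ if i ∈ I then C i else Set.univ} := by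
      ext x
      simp only [Set.mem_prod, Set.mem_pi, Set.mem_ofPred_eq]
      refine and_congr_right fun _ => ⟨fun hx i _ => ?_, fun hx i hi => ?_⟩
      · split_ifs with hi
        · exact hx i hi
        · trivial
      · simpa [Finset.mem_coe.1 hi] using hx i (Finset.mem_range.1 (hn hi))
    rw [happ μ hm, happ μ' hm, hset]
    refine h n s _ hs fun i => ?_
    split_ifs
    · exact hC' i
    · exact MeasurableSet.univ
  · rw [happ μ MeasurableSet.univ, happ μ' MeasurableSet.univ]
    have h0 := h 0 s (fun _ => Set.univ) hs fun _ => MeasurableSet.univ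
    simp only [not_lt_zero, false_implies, implies_true, and_true] at h0
    rw [Set.prod_univ]
    exact h0

open Classical in
/-- The excursions of length `0` are replaced by the zero path. -/
def eraseZero (x : (ℕ → ℝ≥0) × (ℕ → ContPath)) : (ℕ → ℝ≥0) × (ℕ → ContPath) :=
  (x.1, fun i => if x.1 i = 0 then 0 else x.2 i)

theorem measurable_eraseZero : Measurable eraseZero := by
  refine measurable_fst.prodMk (measurable_pi_iff.2 fun i => ?_)
  refine Measurable.ite ?_ measurable_const (by fun_prop)
  exact (by fun_prop : Measurable fun x : (ℕ → ℝ≥0) × (ℕ → ContPath) => x.1 i)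
    (measurableSet_singleton 0)

/-- Given the sequence `z` of lengths, which has law `ρ`, the first excursions are independent with
laws `ν (z i)`. -/
def IsConditionalLaw (ρ : Measure (ℕ → ℝ≥0)) (ν : ℝ≥0 → Measure ContPath)
    (μ : Measure ((ℕ → ℝ≥0) × (ℕ → ContPath))) : Prop :=
  ∀ (n : ℕ) (A : Set (ℕ → ℝ≥0)) (C : ℕ → Set ContPath), MeasurableSet A →
    (∀ i, MeasurableSet (C i)) →
    μ {x | x.1 ∈ A ∧ ∀ i < n, x.2 i ∈ C i} =
      ∫⁻ z in A, ∏ i ∈ Finset.range n, ν (z i) (C i) ∂ρ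

section ConditionalLaw

variable {ρ : Measure (ℕ → ℝ≥0)} [IsFiniteMeasure ρ] {ν ν' : ℝ≥0 → Measure ContPath}
  {μ μ' : Measure ((ℕ → ℝ≥0) × (ℕ → ContPath))}

/-- The conditional laws have mass `1` along the sequence of lengths, since taking all the `C i` to be
the whole space gives the law of the lengths. -/
theorem IsConditionalLaw.ae_measure_univ (h : IsConditionalLaw ρ ν μ)
    (hρ : μ.map Prod.fst = ρ)
    (hν : ∀ C, MeasurableSet C → Measurable fun l => ν l C) :
    ∀ᵐ z ∂ρ, ∀ i, ν (z i) Set.univ = 1 := by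
  have hprod (n : ℕ) : ∀ᵐ z ∂ρ, ∏ i ∈ Finset.range n, ν (z i) Set.univ = 1 := by
    refine ae_eq_of_forall_setLIntegral_eq_of_sigmaFinite
      (Finset.measurable_prod _ fun i _ => (hν _ MeasurableSet.univ).comp (measurable_pi_apply i))
      measurable_const fun A hA _ => ?_
    rw [← h n A (fun _ => Set.univ) hA fun _ => MeasurableSet.univ, setLIntegral_one, ← hρ,
      Measure.map_apply measurable_fst hA]
    congr 1
    ext x
    simp
  filter_upwards [ae_all_iff.2 hprod] with z hz i
  have := hz (i + 1)
  rwa [Finset.prod_range_succ, hz i, one_mul] at this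

/-- The indices below `n` of the terms that vanish. -/
def zeroIndices (n : ℕ) (z : ℕ → ℝ≥0) : Finset ℕ := {i ∈ Finset.range n | z i = 0}

theorem measurableSet_zeroIndices (n : ℕ) (s : Finset ℕ) :
    MeasurableSet {z | zeroIndices n z = s} := by
  have : {z | zeroIndices n z = s} = {z : ℕ → ℝ≥0 | ∀ i, (i < n ∧ z i = 0) ↔ i ∈ s} := by
    ext z
    simp [zeroIndices, Finset.ext_iff]
  rw [this]
  refine measurableSet_setOfPred.2 (Measurable.forall fun i => Measurable.iff
    (measurable_const.and (measurableSet_setOfPred.1 ?_)) measurable_const)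
  exact measurable_pi_apply i (measurableSet_singleton 0)

/-- The conditional laws for positive lengths determine the joint law once the excursions of length
`0` are erased: there, the total mass of the conditional law is `1`, whatever it is. -/
theorem IsConditionalLaw.map_eraseZero_eq (h : IsConditionalLaw ρ ν μ)
    (h' : IsConditionalLaw ρ ν' μ') [IsFiniteMeasure μ] [IsFiniteMeasure μ']
    (hρ : μ.map Prod.fst = ρ) (hρ' : μ'.map Prod.fst = ρ)
    (hν : ∀ C, MeasurableSet C → Measurable fun l => ν l C)
    (hν' : ∀ C, MeasurableSet C → Measurable fun l => ν' l C) (hνν' : ∀ l, 0 < l → ν l = ν' l) :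
    μ.map eraseZero = μ'.map eraseZero := by
  classical
  refine measure_ext_of_rectangles fun n A C hA hC => ?_
  let E : Set ((ℕ → ℝ≥0) × (ℕ → ContPath)) := {x | x.1 ∈ A ∧ ∀ i < n, x.2 i ∈ C i}
  have hE : MeasurableSet E := by
    refine (measurable_fst hA).inter (measurableSet_setOfPred.2 (Measurable.forall fun i =>
      measurable_const.imp (measurableSet_setOfPred.1 ?_)))
    exact (by fun_prop : Measurable fun x : (ℕ → ℝ≥0) × (ℕ → ContPath) => x.2 i) (hC i)
  let F (s : Finset ℕ) : Set ((ℕ → ℝ≥0) × (ℕ → ContPath)) :=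
    eraseZero ⁻¹' E ∩ {x | zeroIndices n x.1 = s}
  have hF (s : Finset ℕ) : MeasurableSet (F s) :=
    (measurable_eraseZero hE).inter (measurable_fst (measurableSet_zeroIndices n s))
  have hFd : Pairwise (Function.onFun Disjoint F) := fun s t hst =>
    Set.disjoint_left.2 fun x hs ht => hst (hs.2.symm.trans ht.2)
  have hEF : eraseZero ⁻¹' E = ⋃ s, F s := by
    ext x
    simp [F]
  change μ.map eraseZero E = μ'.map eraseZero E
  rw [Measure.map_apply measurable_eraseZero hE, Measure.map_apply measurable_eraseZero hE, hEF,
    measure_iUnion hFd hF, measure_iUnion hFd hF]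
  refine tsum_congr fun s => ?_
  by_cases hs : ∀ i < n, i ∈ s → (0 : ContPath) ∈ C i
  · -- On this event no condition bears on the paths with an index in `s`.
    let A' : Set (ℕ → ℝ≥0) := A ∩ {z | zeroIndices n z = s}
    have hA' : MeasurableSet A' := hA.inter (measurableSet_zeroIndices n s)
    let C' (i : ℕ) : Set ContPath := if i ∈ s then Set.univ else C i
    have hC' (i : ℕ) : MeasurableSet (C' i) := by
      simp only [C']
      split_ifs
      · exact MeasurableSet.univ
      · exact hC i
    have hFs : F s = {x | x.1 ∈ A' ∧ ∀ i < n, x.2 i ∈ C' i} := by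
      ext x
      simp only [F, E, A', C', eraseZero, Set.mem_inter_iff, Set.mem_preimage, Set.mem_ofPred_eq]
      rw [and_right_comm]
      refine and_congr_right fun hx => forall₂_congr fun i hi => ?_
      have his : i ∈ s ↔ x.1 i = 0 := by
        rw [← hx.2, zeroIndices, Finset.mem_filter, Finset.mem_range, and_iff_right hi]
      by_cases h0 : x.1 i = 0
      · simp [his, h0, hs i hi (his.2 h0)]
      · simp [his, h0]
    rw [hFs, h n A' C' hA' hC', h' n A' C' hA' hC']
    refine setLIntegral_congr_fun_ae hA' ?_
    filter_upwards [h.ae_measure_univ hρ hν, h'.ae_measure_univ hρ' hν'] with z hz hz' hzA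
    refine Finset.prod_congr rfl fun i hi => ?_
    by_cases his : i ∈ s
    · simp only [C', if_pos his, hz, hz']
    · have h0 : z i ≠ 0 := fun h0 => his (by
        rw [← hzA.2, zeroIndices, Finset.mem_filter]
        exact ⟨hi, h0⟩)
      rw [hνν' _ (pos_of_ne_zero h0)]
  · have hFs : F s = ∅ := by
      refine Set.eq_empty_iff_forall_notMem.2 fun x hx => hs fun i hi his => ?_
      have h0 : x.1 i = 0 := by
        rw [← hx.2, zeroIndices, Finset.mem_filter] at his
        exact his.2
      have := hx.1.2 i hi
      simpa [eraseZero, h0] using this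
    rw [hFs, measure_empty, measure_empty]

end ConditionalLaw

namespace LimitIngredients

variable {Ω Ω' : Type*} [MeasurableSpace Ω] [MeasurableSpace Ω'] {P : Measure Ω}
  {P' : Measure Ω'} {κ σ lam θ : ℝ} {Z : ℕ → Ω → ℝ≥0}
  {h : ℕ → Ω → ContPath} {Q : ℕ → Ω → PointSet} {Z' : ℕ → Ω' → ℝ≥0}
  {h' : ℕ → Ω' → ContPath} {Q' : ℕ → Ω' → PointSet}

theorem exists_lengths (L : LimitIngredients P κ σ lam θ Z h Q) :
    ∃ β : Ω → ContPath, Measurable β ∧ (∃ B, IsBrownianReal B P ∧ ∀ᵐ ω ∂P, ∀ t, β ω t = B t ω) ∧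
      (fun ω i => Z i ω) =ᵐ[P] (fun (w : ContPath) i =>
        rankedLength (reflectedPath (parabolicPath κ σ lam w)) i) ∘ β := by
  obtain ⟨B, hB, hZ⟩ := L.lengths
  obtain ⟨β, hβ, hβB⟩ := hB.exists_contPath
  refine ⟨β, hβ, ⟨B, hB, hβB⟩, ?_⟩
  filter_upwards [ae_all_iff.2 hZ, hβB] with ω hω hω'
  ext i : 1
  rw [hω i, ← funext hω']
  rfl

theorem measurable_lengths :
    Measurable fun (w : ContPath) i => rankedLength (reflectedPath (parabolicPath κ σ lam w)) i :=
  measurable_pi_iff.2 fun i => measurable_rankedLength_reflectedParabola κ σ lam i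

theorem aemeasurable_lengths (L : LimitIngredients P κ σ lam θ Z h Q) :
    AEMeasurable (fun ω i => Z i ω) P := by
  obtain ⟨β, hβ, -, hZ⟩ := L.exists_lengths
  exact ⟨_, measurable_lengths.comp hβ, hZ⟩

theorem map_lengths_eq (L : LimitIngredients P κ σ lam θ Z h Q)
    (L' : LimitIngredients P' κ σ lam θ Z' h' Q') :
    P.map (fun ω i => Z i ω) = P'.map fun ω i => Z' i ω := by
  obtain ⟨β, hβ, ⟨B, hB, hβB⟩, hZ⟩ := L.exists_lengths
  obtain ⟨β', hβ', ⟨B', hB', hβB'⟩, hZ'⟩ := L'.exists_lengths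
  rw [Measure.map_congr hZ, Measure.map_congr hZ', ← Measure.map_map measurable_lengths hβ,
    ← Measure.map_map measurable_lengths hβ',
    map_contPath_eq (hB.map_eq hB') hβ.aemeasurable hβB hβ'.aemeasurable hβB']

theorem aemeasurable_pair (L : LimitIngredients P κ σ lam θ Z h Q) :
    AEMeasurable (fun ω => ((fun i => Z i ω), (fun i => h i ω))) P :=
  L.aemeasurable_lengths.prodMk (aemeasurable_pi_lambda _ L.aemeasurable_exc)

theorem aemeasurable_poisson (L : LimitIngredients P κ σ lam θ Z h Q) :
    AEMeasurable (fun ω i => Q i ω) P :=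
  aemeasurable_pi_lambda _ fun i => (L.poisson i).aemeasurable

theorem map_fst_pair (L : LimitIngredients P κ σ lam θ Z h Q) :
    (P.map fun ω => ((fun i => Z i ω), (fun i => h i ω))).map Prod.fst =
      P.map fun ω i => Z i ω := by
  rw [AEMeasurable.map_map_of_aemeasurable measurable_fst.aemeasurable L.aemeasurable_pair]
  rfl

theorem exists_isConditionalLaw (L : LimitIngredients P κ σ lam θ Z h Q) :
    ∃ ν : ℝ≥0 → Measure ContPath, (∀ l, 0 < l → IsTiltedExcursionLaw θ l (ν l)) ∧
      IsConditionalLaw (P.map fun ω i => Z i ω) ν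
        (P.map fun ω => ((fun i => Z i ω), (fun i => h i ω))) := by
  obtain ⟨ν, hν, hν'⟩ := L.excursions
  refine ⟨ν, hν, fun n A C hA hC => ?_⟩
  have hE : MeasurableSet {x : (ℕ → ℝ≥0) × (ℕ → ContPath) | x.1 ∈ A ∧ ∀ i < n, x.2 i ∈ C i} := by
    refine (measurable_fst hA).inter (measurableSet_setOfPred.2 (Measurable.forall fun i =>
      measurable_const.imp (measurableSet_setOfPred.1 ?_)))
    exact (by fun_prop : Measurable fun x : (ℕ → ℝ≥0) × (ℕ → ContPath) => x.2 i) (hC i)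
  have hφ : Measurable fun z : ℕ → ℝ≥0 => ∏ i ∈ Finset.range n, ν (z i) (C i) :=
    Finset.measurable_prod _ fun i _ =>
      (measurable_isTiltedExcursionLaw hν (hC i)).comp (measurable_pi_apply i)
  rw [Measure.map_apply_of_aemeasurable L.aemeasurable_pair hE, ← lintegral_indicator hA,
    lintegral_map' (hφ.indicator hA).aemeasurable L.aemeasurable_lengths]
  refine (hν' n A C hA hC).trans ?_
  have hnull : NullMeasurableSet {ω | (fun i => Z i ω) ∈ A} P :=
    L.aemeasurable_lengths.nullMeasurableSet_preimage hA
  rw [← lintegral_indicator₀ hnull]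
  rfl

theorem ae_locallyFinite (L : LimitIngredients P κ σ lam θ Z h Q) :
    ∀ᵐ ω ∂P, ∀ i, (Q i ω).LocallyFinite :=
  ae_all_iff.2 fun i => (L.poisson i).ae_locallyFinite

variable [IsProbabilityMeasure P] [IsProbabilityMeasure P']

theorem map_pair_eq (L : LimitIngredients P κ σ lam θ Z h Q)
    (L' : LimitIngredients P' κ σ lam θ Z' h' Q') :
    P.map (fun ω => eraseZero ((fun i => Z i ω), (fun i => h i ω))) =
      P'.map (fun ω => eraseZero ((fun i => Z' i ω), (fun i => h' i ω))) := by
  obtain ⟨ν, hν, hc⟩ := L.exists_isConditionalLaw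
  obtain ⟨ν', hν', hc'⟩ := L'.exists_isConditionalLaw
  rw [← L.map_lengths_eq L'] at hc'
  have hp : IsProbabilityMeasure (P.map fun ω i => Z i ω) :=
    Measure.isProbabilityMeasure_map L.aemeasurable_lengths
  have hp1 : IsProbabilityMeasure (P.map fun ω => ((fun i => Z i ω), (fun i => h i ω))) :=
    Measure.isProbabilityMeasure_map L.aemeasurable_pair
  have hp2 : IsProbabilityMeasure (P'.map fun ω => ((fun i => Z' i ω), (fun i => h' i ω))) :=
    Measure.isProbabilityMeasure_map L'.aemeasurable_pair
  have key := hc.map_eraseZero_eq hc' L.map_fst_pair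
    (L'.map_fst_pair.trans (L.map_lengths_eq L').symm)
    (fun C hC => measurable_isTiltedExcursionLaw hν hC)
    (fun C hC => measurable_isTiltedExcursionLaw hν' hC)
    (fun l hl => (hν l hl).unique (hν' l hl))
  rwa [AEMeasurable.map_map_of_aemeasurable measurable_eraseZero.aemeasurable L.aemeasurable_pair,
    AEMeasurable.map_map_of_aemeasurable measurable_eraseZero.aemeasurable L'.aemeasurable_pair]
    at key

theorem map_poisson_eq (L : LimitIngredients P κ σ lam θ Z h Q)
    (L' : LimitIngredients P' κ σ lam θ Z' h' Q') :
    P.map (fun ω i => Q i ω) = P'.map fun ω i => Q' i ω := by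
  rw [iIndepFun.map_fun_eq_infinitePi_map₀ L.aemeasurable_poisson L.indep_poisson,
    iIndepFun.map_fun_eq_infinitePi_map₀ L'.aemeasurable_poisson L'.indep_poisson,
    funext fun i => (L.poisson i).map_eq (L'.poisson i)]

/-- Up to the excursions of length `0`, the joint law of the ingredients is determined. -/
theorem identDistrib (L : LimitIngredients P κ σ lam θ Z h Q)
    (L' : LimitIngredients P' κ σ lam θ Z' h' Q') :
    IdentDistrib (fun ω => (eraseZero ((fun i => Z i ω), (fun i => h i ω)), fun i => Q i ω))
      (fun ω => (eraseZero ((fun i => Z' i ω), (fun i => h' i ω)), fun i => Q' i ω)) P P' where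
  aemeasurable_fst :=
    (measurable_eraseZero.comp_aemeasurable L.aemeasurable_pair).prodMk L.aemeasurable_poisson
  aemeasurable_snd :=
    (measurable_eraseZero.comp_aemeasurable L'.aemeasurable_pair).prodMk L'.aemeasurable_poisson
  map_eq := by
    have i1 := (L.indep.comp measurable_eraseZero measurable_id)
    have i2 := (L'.indep.comp measurable_eraseZero measurable_id)
    have e1 := (indepFun_iff_map_prod_eq_prod_map_map
      (measurable_eraseZero.comp_aemeasurable L.aemeasurable_pair) L.aemeasurable_poisson).1 i1
    have e2 := (indepFun_iff_map_prod_eq_prod_map_map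
      (measurable_eraseZero.comp_aemeasurable L'.aemeasurable_pair) L'.aemeasurable_poisson).1 i2
    refine e1.trans (Eq.trans ?_ e2.symm)
    rw [L.map_poisson_eq L']
    congr 1
    exact L.map_pair_eq L'

end LimitIngredients

/-! ### The sequence of spaces as a function of the ingredients -/

/-- The rescaled spaces of the Erdős–Rényi limit as a function of the ingredients. -/
def spacesOf {α : ℝ} (hα : 0 < α) (β : ℝ)
    (x : ((ℕ → ℝ≥0) × (ℕ → ContPath)) × (ℕ → PointSet)) (i : ℕ) : MMSpace :=
  MMSpace.scl α β hα (shortcutSpace ((2 : ℝ) • x.1.2 i) (x.1.2 i) (x.1.1 i)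
    (x.2 i).regularize.points)

theorem measurable_spacesOf {α : ℝ} (hα : 0 < α) (β : ℝ) : Measurable (spacesOf hα β) := by
  refine measurable_pi_iff.2 fun i => ?_
  have hh : Measurable fun x : ((ℕ → ℝ≥0) × (ℕ → ContPath)) × (ℕ → PointSet) => x.1.2 i := by
    fun_prop
  exact measurable_scl_shortcutSpace hα (ContPath.measurable_smul 2 hh) hh (by fun_prop)
    (PointSet.measurable_regularize.comp (by fun_prop))
    fun x => PointSet.locallyFinite_regularize _

/-- Neither the erasure of the excursions of length `0` nor the regularization of the sets of points
is visible to a measurable set of spaces. -/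
theorem mem_spacesOf_iff {α : ℝ} (hα : 0 < α) (β : ℝ)
    (x : (ℕ → ℝ≥0) × (ℕ → ContPath)) (q : ℕ → PointSet) (i : ℕ) (hq : (q i).LocallyFinite)
    {S : Set MMSpace} (hS : MeasurableSet S) :
    MMSpace.scl α β hα (shortcutSpace ((2 : ℝ) • x.2 i) (x.2 i) (x.1 i) (q i).points) ∈ S ↔
      spacesOf hα β (eraseZero x, q) i ∈ S := by
  rw [spacesOf, hq.regularize_eq, eraseZero]
  by_cases h0 : x.1 i = 0
  · simp only [h0, if_true]
    exact shortcutSpace_zero_mem_iff_scl hα _ _ _ _ _ _ hS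
  · simp only [h0, if_false]

section Indistinguishable

variable {X : Type*} [MeasurableSpace X]

/-- Sequences whose terms belong to the same measurable sets belong to the same sets of the product
`σ`-algebra. -/
theorem mem_iff_of_forall_eval {x y : ℕ → X}
    (h : ∀ (i : ℕ) (S : Set X), MeasurableSet S → (x i ∈ S ↔ y i ∈ S)) {S : Set (ℕ → X)}
    (hS : MeasurableSet S) : x ∈ S ↔ y ∈ S := by
  let m : MeasurableSpace (ℕ → X) :=
    { MeasurableSet' := fun S => (x ∈ S ↔ y ∈ S)
      measurableSet_empty := by simp
      measurableSet_compl := fun S hS => not_congr hS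
      measurableSet_iUnion := fun f hf => by
        simp only [Set.mem_iUnion]
        exact exists_congr hf }
  have hle : MeasurableSpace.pi ≤ m := by
    refine iSup_le fun i => ?_
    rintro _ ⟨T, hT, rfl⟩
    exact h i T hT
  exact hle S hS

/-- Functions whose values almost surely belong to the same measurable sets have the same law. -/
theorem identDistrib_of_ae_mem_iff {Ω : Type*} [MeasurableSpace Ω] {P : Measure Ω} {f g : Ω → X}
    (hg : AEMeasurable g P)
    (h : ∀ᵐ ω ∂P, ∀ S, MeasurableSet S → (f ω ∈ S ↔ g ω ∈ S)) : IdentDistrib f g P P := by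
  classical
  rcases isEmpty_or_nonempty Ω with hΩ | ⟨⟨ω₀⟩⟩
  · have : f = g := funext fun ω => hΩ.elim ω
    subst this
    exact IdentDistrib.refl hg
  have hmk : ∀ᵐ ω ∂P, ∀ S, MeasurableSet S → (f ω ∈ S ↔ hg.mk g ω ∈ S) := by
    filter_upwards [h, hg.ae_eq_mk] with ω hω hω'
    rw [← hω']
    exact hω
  obtain ⟨N, hN, hNm, hN0⟩ := exists_measurable_superset_of_null (ae_iff.1 hmk)
  have hgN : ∀ ω ∉ N, ∀ S, MeasurableSet S → (f ω ∈ S ↔ hg.mk g ω ∈ S) := fun ω hω => by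
    by_contra hc
    exact hω (hN hc)
  let f' : Ω → X := fun ω => if ω ∈ N then f ω₀ else f ω
  have hf' : Measurable f' := by
    intro S hS
    have : f' ⁻¹' S = N.ite {_ω | f ω₀ ∈ S} (hg.mk g ⁻¹' S) := by
      ext ω
      by_cases hω : ω ∈ N
      · simp [f', hω, Set.ite]
      · simp [f', hω, Set.ite, hgN ω hω S hS]
    rw [this]
    exact hNm.ite (MeasurableSet.const _) (hg.measurable_mk hS)
  have hff' : f =ᵐ[P] f' := by
    filter_upwards [measure_eq_zero_iff_ae_notMem.1 hN0] with ω hω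
    simp [f', hω]
  have hf : AEMeasurable f P := ⟨f', hf', hff'⟩
  refine ⟨hf, hg, ?_⟩
  ext S hS
  rw [Measure.map_apply_of_aemeasurable hf hS, Measure.map_apply_of_aemeasurable hg hS]
  refine measure_congr ?_
  filter_upwards [h] with ω hω
  exact propext (hω S hS)

end Indistinguishable

theorem lemma4p1 {Ω Ω' : Type*} [MeasurableSpace Ω] [MeasurableSpace Ω']
    (P : Measure Ω) [IsProbabilityMeasure P] (P' : Measure Ω') [IsProbabilityMeasure P']
    (σ₁ σ₃ lam : ℝ) (h₁ : 0 < σ₁) (h₃ : 0 < σ₃)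
    (M : ℕ → Ω → MMSpace) (hM : IsRankOneLimit P σ₁ σ₃ lam M)
    (M' : ℕ → Ω' → MMSpace)
    (hM' : IsErdosRenyiLimit P' (lam * σ₁ / σ₃ ^ (2 / 3 : ℝ)) M') :
    IdentDistrib (fun ω i => M i ω)
      (fun ω i => MMSpace.scl (σ₁ / σ₃ ^ (2 / 3 : ℝ)) (σ₁ / σ₃ ^ (1 / 3 : ℝ))
        (div_pos h₁ (Real.rpow_pos_of_pos h₃ _)) (M' i ω)) P P' := by
  obtain ⟨Z, h, Q, L, hM⟩ := hM
  obtain ⟨Z', h', Q', L', hM'⟩ := hM'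
  -- All powers are expressed through `s = σ₁ ^ (1 / 2)` and `t = σ₃ ^ (1 / 6)`.
  obtain ⟨s, hs, hσ₁⟩ : ∃ s : ℝ, 0 < s ∧ σ₁ = s ^ 2 :=
    ⟨√σ₁, Real.sqrt_pos.2 h₁, (Real.sq_sqrt h₁.le).symm⟩
  obtain ⟨t, ht, hσ₃⟩ : ∃ t : ℝ, 0 < t ∧ σ₃ = t ^ 6 := by
    refine ⟨σ₃ ^ (1 / 6 : ℝ), Real.rpow_pos_of_pos h₃ _, ?_⟩
    rw [← Real.rpow_natCast, ← Real.rpow_mul h₃.le]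
    norm_num
  have pow_rpow {x : ℝ} (hx : 0 < x) (n m : ℕ) {r : ℝ} (hr : n * r = m) : (x ^ n) ^ r = x ^ m := by
    rw [← Real.rpow_natCast, ← Real.rpow_mul hx.le, hr, Real.rpow_natCast]
  have e1 : σ₁ ^ (1 / 2 : ℝ) = s := by
    rw [hσ₁, pow_rpow hs 2 1 (by norm_num), pow_one]
  have e2 : σ₁ ^ (3 / 2 : ℝ) = s ^ 3 := by rw [hσ₁, pow_rpow hs 2 3 (by norm_num)]
  have e3 : σ₃ ^ (1 / 2 : ℝ) = t ^ 3 := by rw [hσ₃, pow_rpow ht 6 3 (by norm_num)]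
  have e4 : σ₃ ^ (1 / 3 : ℝ) = t ^ 2 := by rw [hσ₃, pow_rpow ht 6 2 (by norm_num)]
  have e5 : σ₃ ^ (2 / 3 : ℝ) = t ^ 4 := by rw [hσ₃, pow_rpow ht 6 4 (by norm_num)]
  have e6 : √(σ₃ / σ₁) = t ^ 3 / s := by
    rw [hσ₁, hσ₃, show t ^ 6 / s ^ 2 = (t ^ 3 / s) ^ 2 by ring, Real.sqrt_sq (by positivity)]
  have hα := div_pos h₁ (Real.rpow_pos_of_pos h₃ (2 / 3 : ℝ))
  have hβ := div_pos h₁ (Real.rpow_pos_of_pos h₃ (1 / 3 : ℝ))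
  let a : ℝ≥0 := ⟨σ₁ / σ₃ ^ (1 / 3 : ℝ), hβ.le⟩
  have ha : a ≠ 0 := fun h0 => hβ.ne' (congrArg NNReal.toReal h0)
  have haα : (a : ℝ) = s ^ 2 / t ^ 2 := by
    change σ₁ / σ₃ ^ (1 / 3 : ℝ) = _
    rw [e4, hσ₁]
  have hsa : √(a : ℝ) = s / t := by
    rw [haα, show s ^ 2 / t ^ 2 = (s / t) ^ 2 by ring, Real.sqrt_sq (by positivity)]
  have Ls := L.scale ha (lam' := lam * σ₁ / σ₃ ^ (2 / 3 : ℝ)) (b := t ^ 2) (by positivity)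
    (by rw [hsa, e6]; field_simp) (by rw [haα, hσ₁, hσ₃]; field_simp)
    (by rw [haα, e5, hσ₁]; field_simp) (by rw [hsa, haα, e3, e2]; field_simp)
  -- Both limits agree, up to indistinguishable spaces, with `spacesOf` applied to ingredients of the
  -- same law.
  have key := (Ls.identDistrib L').comp (measurable_spacesOf hα (σ₁ / σ₃ ^ (1 / 3 : ℝ)))
  have k1 : IdentDistrib (fun ω i => M i ω) _ P P :=
    identDistrib_of_ae_mem_iff key.aemeasurable_fst (by
      filter_upwards [ae_all_iff.2 hM, Ls.ae_locallyFinite] with ω hω hlf S hS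
      refine mem_iff_of_forall_eval (fun i S hS => ?_) hS
      rw [hω i, shortcutSpace_mem_iff_scl ha hα _ _ _ _ hS, scalePath_smul, scalePath_smul,
        show (σ₁ / σ₃ ^ (2 / 3 : ℝ))⁻¹ * (2 * σ₁ ^ (1 / 2 : ℝ) / σ₃ ^ (1 / 2 : ℝ)) =
          2 * (√(a : ℝ))⁻¹ by rw [hsa, e1, e3, e5, hσ₁]; field_simp,
        show (a : ℝ) * (σ₃ ^ (1 / 2 : ℝ) / σ₁ ^ (3 / 2 : ℝ)) = (√(a : ℝ))⁻¹ by
          rw [hsa, haα, e2, e3]; field_simp]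
      have := mem_spacesOf_iff hα (σ₁ / σ₃ ^ (1 / 3 : ℝ))
        ((fun i => Z i ω / a), fun i => scalePath (√a)⁻¹ a (h i ω))
        (fun i => (Q i ω).scale a a) i (hlf i) hS
      have e7 : scalePath (√a)⁻¹ a (h i ω) = (√a)⁻¹ • scalePath 1 a (h i ω) := by
        ext u; simp [scalePath_apply]
      simp only [e7, smul_smul] at this
      refine Iff.trans this ?_
      simp only [Function.comp_apply])
  have k2 : IdentDistrib (fun ω i => MMSpace.scl (σ₁ / σ₃ ^ (2 / 3 : ℝ)) (σ₁ / σ₃ ^ (1 / 3 : ℝ))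
        hα (M' i ω)) _ P' P' :=
    identDistrib_of_ae_mem_iff key.aemeasurable_snd (by
      filter_upwards [ae_all_iff.2 hM', L'.ae_locallyFinite] with ω hω hlf S hS
      refine mem_iff_of_forall_eval (fun i S hS => ?_) hS
      rw [hω i]
      exact mem_spacesOf_iff hα (σ₁ / σ₃ ^ (1 / 3 : ℝ)) ((fun i => Z' i ω), fun i => h' i ω)
        (fun i => Q' i ω) i (hlf i) hS)
  exact (k1.trans key).trans k2.symm

end
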